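/- Let $\tau=(1+\sqrt5)/2$ and let $\kappa>0$, $\omega>0$ be real. Write $(a)_j=a(a+1)\cdots(a+j-1)$. Let $R_+\subset\mathbb R^3$ be the set of the $15$ positive roots of type $H_3$: $(2,0,0)$, $(0,2,0)$, $(0,0,2)$, $(\tau,\pm\tau^{-1},\pm1)$, $(\pm1,\tau,\pm\tau^{-1})$, $(\tau^{-1},\pm1,\tau)$, $(-\tau^{-1},1,\tau)$, $(\tau^{-1},1,-\tau)$ (independent signs), let $\sigma_v$ be the reflection along $v$, and let $G$ be the icosahedral group generated by the $\sigma_v$, $v\in R_+$. Let $\mathcal D_if(x)=\partial_if(x)+\kappa\sum_{v\in R_+}\frac{f(x)-f(x\sigma_v)}{\langle x,v\rangle}v_i$ be the Dunkl operators and $\Delta_\kappa=\sum_{i=1}^3\mathcal D_i^2$. Let $h_\kappa(x)=\prod_{v\in R_+}|\langle x,v\rangle|^{\kappa}$, and for real polynomials $p$ put $$\|p\|_2^2=c_{\kappa,\omega}\int_{\mathbb R^3}p(x)^2e^{-\omega|x|^2}h_\kappa(x)^2\,dx,\qquad c_{\kappa,\omega}^{-1}=\int_{\mathbb R^3}e^{-\omega|x|^2}h_\kappa(x)^2\,dx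 .$$ Let $\mathcal I=\{(0,\pm\tau,\pm1),(\pm1,0,\pm\tau),(\pm\tau,\pm1,0)\}$ and $\mathcal I_+=\{(0,\tau,\pm1),(1,0,\pm\tau),(\tau,\pm1,0)\}$. For $y_0\in\mathcal I$ define polynomials $q_m(x;y_0)$ by $$(1-r\langle x,y_0\rangle)^{-1}\prod_{y\in\mathcal I}(1-r\langle x,y\rangle)^{-\kappa}=\sum_{m\ge0}q_m(x;y_0)r^m ,$$ put $\nu(m)=2^m(6\kappa+1)_{\lfloor m/2\rfloor}(5\kappa+\tfrac12)_{\lfloor (m+1)/2\rfloor}$, and $$w_m(x;y_0)=\sum_{j=0}^{\lfloor m/2\rfloor}(-1)^j\frac{(\tau+2)^j}{(4\omega)^jj!}\frac{\nu(m)}{\nu(m-2j)}q_{m-2j}(x;y_0),$$ $$\phi_m(x;y_0)=\sum_{j=0}^{\lfloor m/2\rfloor}\frac{(\tau+2)^j|x|^{2j}}{4^jj!\,(-15\kappa-m+\frac12)_j}\frac{\nu(m)}{\nu(m-2j)}q_{m-2j}(x;y_0).$$ Let $w_{2n}^G=\sum_{y\in\mathcal I_+}w_{2n}(\cdot;y)$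 and $\phi_{2n}^G=\sum_{y\in\mathcal I_+}\phi_{2n}(\cdot;y)$, and $$Y_n^{(0)}=\sum_{j=0}^n\frac{(\kappa+1)_j(5\kappa)_{n-j}}{j!\,(n-j)!}5^j,\quad Y_n^{(1)}=\sum_{j=0}^n\frac{(\kappa)_j(5\kappa+1)_{n-j}}{j!\,(n-j)!}5^j,\quad Y_n^{(2)}=\Big(6+\frac n\kappa\Big)\sum_{j=0}^n\frac{(\kappa)_j(5\kappa)_{n-j}}{j!\,(n-j)!}5^j .$$ Then for every integer $n\ge0$ the polynomial $\phi_{2n}^G$ is homogeneous of degree $2n$, $G$-invariant, and satisfies $\Delta_\kappa\phi_{2n}^G=0$; the integrals defining $c_{\kappa,\omega}^{-1}$ (which is positive), $\|\phi_{2n}^G\|_2^2$ and $\|w_{2n}^G\|_2^2$ converge; and $$\|\phi_{2n}^G\|_2^2=6\tau^{2n}\frac{\nu(2n)}{(2\omega)^{2n}}\sum_{j=0}^n\frac{5^j(-6\kappa-n)_j(-5\kappa-n+\frac12)_j}{j!\,(-15\kappa-2n+\frac12)_j}\,Y^{(2)}_{n-j},$$ $$Y_n^{(0)}+5Y_n^{(1)}=Y_n^{(2)},\qquad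 \|w_{2n}^G\|_2^2=6\tau^{2n}\frac{\nu(2n)}{(2\omega)^{2n}}\,Y_n^{(2)} .$$ -/

import Mathlib

open scoped BigOperators Matrix

noncomputable section

namespace Icosahedral

/-! The space is `Fin 3 → ℝ` with the dot product `x ⬝ᵥ y`; polynomials in three variables are
elements of `MvPolynomial (Fin 3) ℝ`. The rising factorial `(a)_j` is
`(ascPochhammer ℝ j).eval a`. -/

/-- The golden ratio `(1 + √5) / 2`. -/
abbrev τ : ℝ := Real.goldenRatio

/-- The Pochhammer symbol `(a)_j = a (a + 1) ⋯ (a + j - 1)`. -/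
def poch (a : ℝ) (j : ℕ) : ℝ := (ascPochhammer ℝ j).eval a

/-! ### Root system, reflection group, icosahedron -/

/-- The fifteen positive roots of type `H₃` (all of squared length 4). -/
def posRoots : Finset (Fin 3 → ℝ) :=
  {![2, 0, 0], ![0, 2, 0], ![0, 0, 2],
   ![τ, τ⁻¹, 1], ![τ, τ⁻¹, -1], ![τ, -τ⁻¹, 1], ![τ, -τ⁻¹, -1],
   ![1, τ, τ⁻¹], ![1, τ, -τ⁻¹], ![-1, τ, τ⁻¹], ![-1, τ, -τ⁻¹],
   ![τ⁻¹, 1, τ], ![τ⁻¹, -1, τ], ![-τ⁻¹, 1, τ], ![τ⁻¹, 1, -τ]}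

/-- The twelve vertices of the icosahedron. -/
def vertices : Finset (Fin 3 → ℝ) :=
  {![0, τ, 1], ![0, τ, -1], ![0, -τ, 1], ![0, -τ, -1],
   ![1, 0, τ], ![1, 0, -τ], ![-1, 0, τ], ![-1, 0, -τ],
   ![τ, 1, 0], ![τ, -1, 0], ![-τ, 1, 0], ![-τ, -1, 0]}

/-- The six vertices on the positive side of `(3, 2τ, 1)`: one from each antipodal pair. -/
def posVertices : Finset (Fin 3 → ℝ) :=
  {![0, τ, 1], ![0, τ, -1], ![1, 0, τ], ![1, 0, -τ], ![τ, 1, 0], ![τ, -1, 0]}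

/-- The reflection along `v`: `x ↦ x - 2 (⟨x, v⟩ / |v|²) v` (the identity if `v = 0`). -/
def reflection (v : Fin 3 → ℝ) : (Fin 3 → ℝ) ≃ₗ[ℝ] (Fin 3 → ℝ) :=
  LinearEquiv.ofInvolutive
    { toFun := fun x => x - (2 * (x ⬝ᵥ v) / (v ⬝ᵥ v)) • v
      map_add' := fun x y => by
        simp only [add_dotProduct, mul_add, add_div, add_smul]; abel
      map_smul' := fun c x => by
        simp only [smul_dotProduct, smul_eq_mul, RingHom.id_apply, smul_sub, smul_smul]
        congr 2; ring }
    (fun x => by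
      by_cases hv : v ⬝ᵥ v = 0
      · simp [hv]
      · simp only [LinearMap.coe_mk, AddHom.coe_mk, sub_dotProduct, smul_dotProduct, smul_eq_mul]
        rw [sub_sub, ← add_smul]
        have : 2 * (x ⬝ᵥ v) / (v ⬝ᵥ v) +
            2 * (x ⬝ᵥ v - 2 * (x ⬝ᵥ v) / (v ⬝ᵥ v) * (v ⬝ᵥ v)) / (v ⬝ᵥ v) = 0 := by
          field_simp; ring
        rw [this]; simp)

theorem reflection_apply (v x : Fin 3 → ℝ) :
    reflection v x = x - (2 * (x ⬝ᵥ v) / (v ⬝ᵥ v)) • v := rfl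

/-- The icosahedral group `G`, generated by the reflections along the roots. -/
def icosahedralGroup : Subgroup ((Fin 3 → ℝ) ≃ₗ[ℝ] (Fin 3 → ℝ)) :=
  Subgroup.closure {w | ∃ v ∈ posRoots, w = reflection v}

/-- `p` is invariant under the icosahedral group. -/
def IsInvariant (p : MvPolynomial (Fin 3) ℝ) : Prop :=
  ∀ w ∈ icosahedralGroup, ∀ x : Fin 3 → ℝ, MvPolynomial.eval (w x) p = MvPolynomial.eval x p

/-! ### Dunkl operators -/

theorem exists_dividedDiff (v : Fin 3 → ℝ) (p : MvPolynomial (Fin 3) ℝ) :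
    ∃ q : MvPolynomial (Fin 3) ℝ, ∀ x : Fin 3 → ℝ,
      (x ⬝ᵥ v) * MvPolynomial.eval x q =
        MvPolynomial.eval x p - MvPolynomial.eval (reflection v x) p := by
  suffices h : ∃ q r : MvPolynomial (Fin 3) ℝ, ∀ x : Fin 3 → ℝ,
      MvPolynomial.eval x r = MvPolynomial.eval (reflection v x) p ∧
      (x ⬝ᵥ v) * MvPolynomial.eval x q =
        MvPolynomial.eval x p - MvPolynomial.eval (reflection v x) p by
    obtain ⟨q, r, h⟩ := h
    exact ⟨q, fun x => (h x).2⟩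
  induction p using MvPolynomial.induction_on with
  | C a => exact ⟨0, MvPolynomial.C a, fun x => by simp⟩
  | add p₁ p₂ h₁ h₂ =>
    obtain ⟨q₁, r₁, h₁⟩ := h₁
    obtain ⟨q₂, r₂, h₂⟩ := h₂
    refine ⟨q₁ + q₂, r₁ + r₂, fun x => ⟨?_, ?_⟩⟩
    · simp [(h₁ x).1, (h₂ x).1]
    · simp only [map_add, mul_add, (h₁ x).2, (h₂ x).2]; ring
  | mul_X p i h =>
    obtain ⟨q, r, h⟩ := h
    let L : MvPolynomial (Fin 3) ℝ := ∑ k, MvPolynomial.C (v k) * MvPolynomial.X k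
    have hL : ∀ x : Fin 3 → ℝ, MvPolynomial.eval x L = x ⬝ᵥ v := fun x => by
      simp [L, dotProduct, mul_comm]
    refine ⟨q * MvPolynomial.X i + r * MvPolynomial.C (2 / (v ⬝ᵥ v) * v i),
      r * (MvPolynomial.X i - MvPolynomial.C (2 / (v ⬝ᵥ v) * v i) * L), fun x => ⟨?_, ?_⟩⟩
    · simp only [map_mul, map_sub, MvPolynomial.eval_X, MvPolynomial.eval_C, hL, (h x).1,
        reflection_apply, Pi.sub_apply, Pi.smul_apply, smul_eq_mul]
      ring
    · have h2 := (h x).2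
      simp only [map_mul, map_add, MvPolynomial.eval_X, MvPolynomial.eval_C, (h x).1]
      simp only [reflection_apply, Pi.sub_apply, Pi.smul_apply, smul_eq_mul] at h2 ⊢
      linear_combination x i * h2

/-- The polynomial `(p(x) - p(x σ_v)) / ⟨x, v⟩`. -/
def dividedDiff (v : Fin 3 → ℝ) (p : MvPolynomial (Fin 3) ℝ) : MvPolynomial (Fin 3) ℝ :=
  (exists_dividedDiff v p).choose

theorem dividedDiff_spec (v : Fin 3 → ℝ) (p : MvPolynomial (Fin 3) ℝ) (x : Fin 3 → ℝ) :
    (x ⬝ᵥ v) * MvPolynomial.eval x (dividedDiff v p) =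
      MvPolynomial.eval x p - MvPolynomial.eval (reflection v x) p :=
  (exists_dividedDiff v p).choose_spec x

/-- The Dunkl operator `𝒟_i p = ∂_i p + κ ∑_{v > 0} v_i (p(x) - p(x σ_v)) / ⟨x, v⟩`. -/
def dunkl (κ : ℝ) (i : Fin 3) (p : MvPolynomial (Fin 3) ℝ) : MvPolynomial (Fin 3) ℝ :=
  MvPolynomial.pderiv i p + ∑ v ∈ posRoots, MvPolynomial.C (κ * v i) * dividedDiff v p

/-- The Dunkl Laplacian `Δ_κ = ∑_i 𝒟_i²`. -/
def dunklLaplacian (κ : ℝ) (p : MvPolynomial (Fin 3) ℝ) : MvPolynomial (Fin 3) ℝ :=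
  ∑ i, dunkl κ i (dunkl κ i p)

/-! ### The inner product -/

/-- The weight `h_κ(x) = ∏_{v > 0} |⟨x, v⟩|^κ`. -/
def weight (κ : ℝ) (x : Fin 3 → ℝ) : ℝ := ∏ v ∈ posRoots, |x ⬝ᵥ v| ^ κ

/-- The density `exp(-ω |x|²) h_κ(x)²` with respect to Lebesgue measure. -/
def density (κ ω : ℝ) (x : Fin 3 → ℝ) : ℝ := Real.exp (-ω * (x ⬝ᵥ x)) * weight κ x ^ 2

/-- The normalization constant `c_{κ,ω}`, the reciprocal of the total mass of the density. -/
def normConst (κ ω : ℝ) : ℝ := (∫ x : Fin 3 → ℝ, density κ ω x)⁻¹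

/-- `⟨p, q⟩₂ = c_{κ,ω} ∫ p(x) q(x) exp(-ω |x|²) h_κ(x)² dx`. -/
def inner₂ (κ ω : ℝ) (p q : MvPolynomial (Fin 3) ℝ) : ℝ :=
  normConst κ ω *
    ∫ x : Fin 3 → ℝ, MvPolynomial.eval x p * MvPolynomial.eval x q * density κ ω x

/-- `‖p‖₂² = ⟨p, p⟩₂`. -/
def normSq₂ (κ ω : ℝ) (p : MvPolynomial (Fin 3) ℝ) : ℝ := inner₂ κ ω p p

/-! ### The special polynomials -/

/-- The linear form `⟨x, y⟩` as a polynomial in `x`. -/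
def linForm (y : Fin 3 → ℝ) : MvPolynomial (Fin 3) ℝ :=
  ∑ i, MvPolynomial.C (y i) * MvPolynomial.X i

/-- `|x|²` as a polynomial. -/
def radiusSq : MvPolynomial (Fin 3) ℝ := ∑ i, MvPolynomial.X i ^ 2

/-- The power series `(1 - r a)^{-s} = ∑_m (s)_m / m! a^m r^m` in the variable `r`. -/
def negBinom (s : ℝ) (a : MvPolynomial (Fin 3) ℝ) : PowerSeries (MvPolynomial (Fin 3) ℝ) :=
  PowerSeries.mk fun m => MvPolynomial.C (poch s m / (m.factorial : ℝ)) * a ^ m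

/-- The generating function
`F(r, x; y₀) = (1 - r⟨x, y₀⟩)⁻¹ ∏_y (1 - r⟨x, y⟩)^{-κ}`, `y` over all twelve vertices,
as a power series in `r` with coefficients polynomial in `x`. -/
def genFun (κ : ℝ) (y₀ : Fin 3 → ℝ) : PowerSeries (MvPolynomial (Fin 3) ℝ) :=
  negBinom 1 (linForm y₀) * ∏ y ∈ vertices, negBinom κ (linForm y)

/-- `q_n(x; y₀)`, the coefficient of `r^n` in the generating function. -/
def q (κ : ℝ) (n : ℕ) (y₀ : Fin 3 → ℝ) : MvPolynomial (Fin 3) ℝ :=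
  PowerSeries.coeff n (genFun κ y₀)

/-- `ν(n) = 2^n (6κ + 1)_{⌊n/2⌋} (5κ + 1/2)_{⌊(n+1)/2⌋}`. -/
def nu (κ : ℝ) (n : ℕ) : ℝ :=
  2 ^ n * poch (6 * κ + 1) (n / 2) * poch (5 * κ + 1 / 2) ((n + 1) / 2)

/-- The inhomogeneous polynomial `w_n(x; y₀)`. -/
def w (κ ω : ℝ) (n : ℕ) (y₀ : Fin 3 → ℝ) : MvPolynomial (Fin 3) ℝ :=
  ∑ j ∈ Finset.range (n / 2 + 1),
    MvPolynomial.C ((-1) ^ j * ((τ + 2) ^ j / ((4 * ω) ^ j * (j.factorial : ℝ))) *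
      (nu κ n / nu κ (n - 2 * j))) * q κ (n - 2 * j) y₀

/-- The homogeneous polynomial `φ_n(x; y₀)`. -/
def phi (κ : ℝ) (n : ℕ) (y₀ : Fin 3 → ℝ) : MvPolynomial (Fin 3) ℝ :=
  ∑ j ∈ Finset.range (n / 2 + 1),
    MvPolynomial.C ((τ + 2) ^ j /
        (4 ^ j * (j.factorial : ℝ) * poch (-15 * κ - (n : ℝ) + 1 / 2) j) *
      (nu κ n / nu κ (n - 2 * j))) * radiusSq ^ j * q κ (n - 2 * j) y₀

/-- `w_{2n}^G`, of degree `2 * n`. -/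
def wG (κ ω : ℝ) (n : ℕ) : MvPolynomial (Fin 3) ℝ := ∑ y ∈ posVertices, w κ ω (2 * n) y

/-- `φ_{2n}^G`, of degree `2 * n`. -/
def phiG (κ : ℝ) (n : ℕ) : MvPolynomial (Fin 3) ℝ := ∑ y ∈ posVertices, phi κ (2 * n) y

/-! ### The sums `Y_n^{(i)}` -/

def Y0 (κ : ℝ) (n : ℕ) : ℝ :=
  ∑ j ∈ Finset.range (n + 1), poch (κ + 1) j * poch (5 * κ) (n - j) /
    ((j.factorial : ℝ) * ((n - j).factorial : ℝ)) * 5 ^ j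

def Y1 (κ : ℝ) (n : ℕ) : ℝ :=
  ∑ j ∈ Finset.range (n + 1), poch κ j * poch (5 * κ + 1) (n - j) /
    ((j.factorial : ℝ) * ((n - j).factorial : ℝ)) * 5 ^ j

def Y2 (κ : ℝ) (n : ℕ) : ℝ :=
  (6 + (n : ℝ) / κ) * ∑ j ∈ Finset.range (n + 1), poch κ j * poch (5 * κ) (n - j) /
    ((j.factorial : ℝ) * ((n - j).factorial : ℝ)) * 5 ^ j

end Icosahedral

end

/-! Write `E_n(x; y) = q_n(x; y) / ν(n)` (`dunklPow`). Everything rests on the relation `𝒟_i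
E_{n+1}(·; y) = y_i E_n(·; y)` for a vertex `y`, so that `E_n` behaves like `⟨x, y⟩^n / n!` under
ordinary derivatives. It comes from the generating function: the factor over all vertices is
invariant, the difference part of `𝒟_i` acts only on the simple pole at `y`, and the reflections
move `y` to each of the ten vertices other than `±y` exactly once. All terms carrying `z_i` for the
other vertices `z` then cancel, and what remains is `y_i` times an Euler operator (`dunkl_q_succ`).

Since `|y|² = τ + 2`, the Dunkl Laplacian sends `E_{n+2}` to `(τ + 2) E_n`, and `w_n / ν(n)` is
`exp(-Δ_κ / 4ω) E_n` (`hermitePow`). In the Gaussian inner product the adjoint of `𝒟_i` is `2ω x_i -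
𝒟_i` (`gaussMean_dunkl_mul_add`), proved by integrating by parts against a smoothed weight.
Induction on degree shows that `hermitePow` is orthogonal to lower degrees and that, for homogeneous
`p` of degree `n`, its pairing with `p` is `p(y) / (2ω)^n` (`gaussMean_mul_hermitePow`).

Hence `‖w_{2n}^G‖²` is a sum of values of `q_{2n}` at vertices. The products of `y` with the
vertices are `±(τ + 2)` once and `±τ` five times, and `(τ + 2)² = 5τ²`, so these values are
coefficients of `(1 - 5τ²X)^{-s} (1 - τ²X)^{-t}`. The identity between the sums `Y` is the Euler
operator applied to the case `s = κ`, `t = 5κ`.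

The coefficients of `φ_{2n}^G` make its Laplacian telescope to zero. By a Green identity it is
orthogonal to every `|x|^{2j}` multiple of an invariant sum of `E_{2k}` with `k < n`. Its norm
therefore involves only its top term, and the reproducing property turns that into the values of
`φ_{2n}^G` at the six vertices. -/

noncomputable section
namespace Icosahedral

/-! ### Exact arithmetic in `ℤ[τ]` -/

/-- The real number `a + b τ` encoded by the pair `(a, b)`. -/
def goldenVal (z : ℤ × ℤ) : ℝ := z.1 + z.2 * τ

/-- Multiplication of the pairs encoding elements of `ℤ[τ]`. -/
def goldenMul (z u : ℤ × ℤ) : ℤ × ℤ := (z.1 * u.1 + z.2 * u.2, z.1 * u.2 + z.2 * u.1 + z.2 * u.2)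

/-- The dot product of vectors over `ℤ[τ]`. -/
def goldenDot (x y : Fin 3 → ℤ × ℤ) : ℤ × ℤ :=
  goldenMul (x 0) (y 0) + goldenMul (x 1) (y 1) + goldenMul (x 2) (y 2)

/-- Half of an element of `ℤ[τ]`, rounded down. -/
def goldenHalf (z : ℤ × ℤ) : ℤ × ℤ := (z.1 / 2, z.2 / 2)

/-- The reflection of `x` along a root `v` of squared length `4`. -/
def goldenReflect (v x : Fin 3 → ℤ × ℤ) : Fin 3 → ℤ × ℤ :=
  fun i => x i - goldenMul (goldenHalf (goldenDot x v)) (v i)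

/-- The real vector encoded by a vector of pairs. -/
def goldenVec (x : Fin 3 → ℤ × ℤ) : Fin 3 → ℝ := fun i => goldenVal (x i)

/-- Irrationality of `τ`. It allows the real root and vertex sets to be treated as embedded copies
of integer data, on which finite claims are decidable. -/
theorem goldenVal_injective : Function.Injective goldenVal := by
  rintro ⟨a, b⟩ ⟨c, d⟩ h
  simp only [goldenVal] at h
  have hb : b = d := by
    by_contra hbd
    have hne : (b : ℝ) - d ≠ 0 := sub_ne_zero.2 (by exact_mod_cast hbd)
    have : τ = ((c - a : ℤ) / (b - d : ℤ) : ℚ) := by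
      push_cast
      rw [eq_div_iff hne]
      linear_combination h
    exact Real.goldenRatio_irrational ⟨_, this.symm⟩
  subst hb
  have : (a : ℝ) = c := by linarith
  simp [Int.cast_injective this]

theorem goldenVec_injective : Function.Injective goldenVec := fun _ _ h =>
  funext fun i => goldenVal_injective (congrFun h i)

theorem goldenVal_add (z u : ℤ × ℤ) : goldenVal (z + u) = goldenVal z + goldenVal u := by
  simp [goldenVal]; ring

theorem goldenVal_sub (z u : ℤ × ℤ) : goldenVal (z - u) = goldenVal z - goldenVal u := by
  simp [goldenVal]; ring

theorem goldenVal_neg (z : ℤ × ℤ) : goldenVal (-z) = -goldenVal z := by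
  simp [goldenVal]; ring

theorem goldenVal_mul (z u : ℤ × ℤ) :
    goldenVal (goldenMul z u) = goldenVal z * goldenVal u := by
  have h := Real.goldenRatio_sq
  simp only [goldenVal, goldenMul]; push_cast
  linear_combination (-(z.2 : ℝ) * u.2) * h

theorem goldenVec_neg (x : Fin 3 → ℤ × ℤ) : goldenVec (-x) = -goldenVec x :=
  funext fun i => goldenVal_neg (x i)

theorem goldenVal_dot (x y : Fin 3 → ℤ × ℤ) :
    goldenVal (goldenDot x y) = goldenVec x ⬝ᵥ goldenVec y := by
  simp [goldenDot, goldenVal_add, goldenVal_mul, dotProduct, Fin.sum_univ_three, goldenVec]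

/-- The positive roots over `ℤ[τ]`. -/
def rootCodes : Finset (Fin 3 → ℤ × ℤ) :=
  {![(2, 0), 0, 0], ![0, (2, 0), 0], ![0, 0, (2, 0)],
   ![(0, 1), (-1, 1), (1, 0)], ![(0, 1), (-1, 1), (-1, 0)],
   ![(0, 1), (1, -1), (1, 0)], ![(0, 1), (1, -1), (-1, 0)],
   ![(1, 0), (0, 1), (-1, 1)], ![(1, 0), (0, 1), (1, -1)],
   ![(-1, 0), (0, 1), (-1, 1)], ![(-1, 0), (0, 1), (1, -1)],
   ![(-1, 1), (1, 0), (0, 1)], ![(-1, 1), (-1, 0), (0, 1)],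
   ![(1, -1), (1, 0), (0, 1)], ![(-1, 1), (1, 0), (0, -1)]}

/-- The vertices over `ℤ[τ]`. -/
def vertexCodes : Finset (Fin 3 → ℤ × ℤ) :=
  {![0, (0, 1), (1, 0)], ![0, (0, 1), (-1, 0)], ![0, (0, -1), (1, 0)], ![0, (0, -1), (-1, 0)],
   ![(1, 0), 0, (0, 1)], ![(1, 0), 0, (0, -1)], ![(-1, 0), 0, (0, 1)], ![(-1, 0), 0, (0, -1)],
   ![(0, 1), (1, 0), 0], ![(0, 1), (-1, 0), 0], ![(0, -1), (1, 0), 0], ![(0, -1), (-1, 0), 0]}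

/-- The vertices on the positive side over `ℤ[τ]`. -/
def posVertexCodes : Finset (Fin 3 → ℤ × ℤ) :=
  {![0, (0, 1), (1, 0)], ![0, (0, 1), (-1, 0)], ![(1, 0), 0, (0, 1)], ![(1, 0), 0, (0, -1)],
   ![(0, 1), (1, 0), 0], ![(0, 1), (-1, 0), 0]}

theorem inv_tau : τ⁻¹ = τ - 1 := by
  have h := Real.goldenRatio_sq
  refine inv_eq_of_mul_eq_one_right ?_
  linear_combination h

theorem goldenVec_cons (a b c : ℤ × ℤ) :
    goldenVec ![a, b, c] = ![goldenVal a, goldenVal b, goldenVal c] := by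
  ext i; fin_cases i <;> rfl

theorem posRoots_eq : posRoots = rootCodes.map ⟨goldenVec, goldenVec_injective⟩ := by
  have h : -(τ - 1) = 1 - τ := by ring
  rw [posRoots, inv_tau, h]
  ext x
  simp [rootCodes, goldenVec_cons, goldenVal, sub_eq_add_neg, add_comm]

theorem vertices_eq : vertices = vertexCodes.map ⟨goldenVec, goldenVec_injective⟩ := by
  ext x
  simp [vertices, vertexCodes, goldenVec_cons, goldenVal]

theorem posVertices_eq : posVertices = posVertexCodes.map ⟨goldenVec, goldenVec_injective⟩ := by
  ext x
  simp [posVertices, posVertexCodes, goldenVec_cons, goldenVal]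

/-! ### Finite checks on roots and vertices. -/

theorem rootCodes_dot : ∀ v ∈ rootCodes, goldenDot v v = (4, 0) := by decide +kernel

/-- `goldenHalf` rounds, so `goldenReflect` is the true reflection only where the dot product is
divisible by 2. This and the next lemma certify that on vertices and roots. -/
theorem vertexCodes_even : ∀ v ∈ rootCodes, ∀ y ∈ vertexCodes,
    goldenHalf (goldenDot y v) + goldenHalf (goldenDot y v) = goldenDot y v := by decide +kernel

theorem rootCodes_even : ∀ v ∈ rootCodes, ∀ y ∈ rootCodes,
    goldenHalf (goldenDot y v) + goldenHalf (goldenDot y v) = goldenDot y v := by decide +kernel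

/-- A reflection permutes the roots up to sign; after each image is returned to the positive system,
the fifteen roots reappear, each once. -/
theorem rootCodes_reflect : ∀ v ∈ rootCodes,
    (rootCodes.val.map fun u => if goldenReflect v u ∈ rootCodes then goldenReflect v u
      else -goldenReflect v u) = rootCodes.val := by decide +kernel

theorem goldenReflect_roots : ∀ v ∈ rootCodes, ∀ y ∈ vertexCodes,
    goldenReflect v y ∈ vertexCodes := by decide +kernel

/-- The roots orthogonal to `y` fix it and are left out. Equality of multisets records that no other
vertex is reached twice. -/
theorem goldenReflect_orbit : ∀ y ∈ vertexCodes,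
    ((rootCodes.filter fun v => goldenDot y v ≠ 0).val.map fun v => goldenReflect v y) =
      ((vertexCodes.erase y).erase (-y)).val := by decide +kernel

theorem vertexCodes_dots : ∀ y ∈ vertexCodes,
    (vertexCodes.val.map fun z => goldenDot y z) =
      {(2, 1), (-2, -1), (0, 1), (0, 1), (0, 1), (0, 1), (0, 1),
        (0, -1), (0, -1), (0, -1), (0, -1), (0, -1)} := by decide +kernel

theorem vertexCodes_split :
    vertexCodes.val = posVertexCodes.val + posVertexCodes.val.map fun y => -y := by decide +kernel

theorem vertexCodes_neg : ∀ y ∈ vertexCodes, -y ∈ vertexCodes ∧ -y ≠ y := by decide +kernel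

/-! ### Roots and vertices -/

theorem root_dot {v : Fin 3 → ℝ} (hv : v ∈ posRoots) : v ⬝ᵥ v = 4 := by
  rw [posRoots_eq, Finset.mem_map] at hv
  obtain ⟨z, hz, rfl⟩ := hv
  change goldenVec z ⬝ᵥ goldenVec z = 4
  rw [← goldenVal_dot, rootCodes_dot z hz]
  norm_num [goldenVal]

theorem reflection_root {v : Fin 3 → ℝ} (hv : v ∈ posRoots) (x : Fin 3 → ℝ) :
    reflection v x = x - ((x ⬝ᵥ v) / 2) • v := by
  rw [reflection_apply, root_dot hv]
  congr 2; ring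

theorem goldenVec_reflect {v y : Fin 3 → ℤ × ℤ} (hv : v ∈ rootCodes)
    (h : goldenHalf (goldenDot y v) + goldenHalf (goldenDot y v) = goldenDot y v) :
    goldenVec (goldenReflect v y) = reflection (goldenVec v) (goldenVec y) := by
  have h' := congrArg goldenVal h
  rw [goldenVal_add, goldenVal_dot] at h'
  rw [reflection_root (by rw [posRoots_eq]; exact Finset.mem_map_of_mem _ hv)]
  ext i
  simp [goldenVec, goldenReflect, goldenVal_sub, goldenVal_mul]
  left
  linarith

/-- Positive roots are preserved only up to sign, which is why `g` must be even. -/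
theorem prod_roots_reflection {M : Type*} [CommMonoid M] {v : Fin 3 → ℝ} (hv : v ∈ posRoots)
    (g : (Fin 3 → ℝ) → M) (hg : ∀ u, g (-u) = g u) :
    ∏ u ∈ posRoots, g (reflection v u) = ∏ u ∈ posRoots, g u := by
  rw [posRoots_eq, Finset.mem_map] at hv
  obtain ⟨a, ha, rfl⟩ := hv
  change ∏ u ∈ posRoots, g (reflection (goldenVec a) u) = ∏ u ∈ posRoots, g u
  rw [posRoots_eq, Finset.prod_map, Finset.prod_map]
  have h := congrArg (fun s => (Multiset.map (fun u => g (goldenVec u)) s).prod)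
    (rootCodes_reflect a ha)
  simp only [Multiset.map_map, Function.comp_def] at h
  refine Eq.trans (Finset.prod_congr rfl fun u hu => ?_) h
  rw [Function.Embedding.coeFn_mk, ← goldenVec_reflect ha (rootCodes_even a ha u hu)]
  split_ifs
  · rfl
  · rw [goldenVec_neg, hg]

theorem reflection_mem_vertices {v y : Fin 3 → ℝ} (hv : v ∈ posRoots) (hy : y ∈ vertices) :
    reflection v y ∈ vertices := by
  rw [posRoots_eq, Finset.mem_map] at hv
  rw [vertices_eq, Finset.mem_map] at hy ⊢
  obtain ⟨a, ha, rfl⟩ := hv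
  obtain ⟨b, hb, rfl⟩ := hy
  exact ⟨_, goldenReflect_roots a ha b hb, goldenVec_reflect ha (vertexCodes_even a ha b hb)⟩

theorem neg_mem_vertices {y : Fin 3 → ℝ} (hy : y ∈ vertices) : -y ∈ vertices := by
  rw [vertices_eq, Finset.mem_map] at hy ⊢
  obtain ⟨b, hb, rfl⟩ := hy
  exact ⟨_, (vertexCodes_neg b hb).1, goldenVec_neg b⟩

theorem posVertices_subset : posVertices ⊆ vertices := by
  intro y hy
  simp only [posVertices, vertices, Finset.mem_insert, Finset.mem_singleton] at hy ⊢
  tauto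

theorem sum_vertices_eq_sum_posVertices {M : Type*} [AddCommMonoid M] (g : (Fin 3 → ℝ) → M) :
    ∑ y ∈ vertices, g y = ∑ y ∈ posVertices, (g y + g (-y)) := by
  rw [vertices_eq, posVertices_eq, Finset.sum_map, Finset.sum_map, Finset.sum_add_distrib]
  rw [Finset.sum, vertexCodes_split, Multiset.map_add, Multiset.sum_add, Multiset.map_map]
  simp only [Function.comp_def, Function.Embedding.coeFn_mk, goldenVec_neg]
  rfl

theorem card_posVertices : posVertices.card = 6 := by
  rw [posVertices_eq, Finset.card_map]; rfl

theorem card_posRoots : posRoots.card = 15 := by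
  rw [posRoots_eq, Finset.card_map]; rfl

theorem map_dot_vertices {y : Fin 3 → ℝ} (hy : y ∈ vertices) :
    (vertices.val.map fun z => y ⬝ᵥ z) =
      {τ + 2, -(τ + 2), τ, τ, τ, τ, τ, -τ, -τ, -τ, -τ, -τ} := by
  rw [vertices_eq, Finset.mem_map] at hy
  obtain ⟨b, hb, rfl⟩ := hy
  have h := congrArg (Multiset.map goldenVal) (vertexCodes_dots b hb)
  rw [Multiset.map_map] at h
  simp only [Function.comp_def, goldenVal_dot] at h
  rw [vertices_eq, Finset.map_val, Multiset.map_map]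
  refine Eq.trans h ?_
  simp [goldenVal, add_comm]

theorem sum_dot_vertices {M : Type*} [AddCommMonoid M] {y : Fin 3 → ℝ} (hy : y ∈ vertices)
    (g : ℝ → M) : ∑ z ∈ vertices, g (y ⬝ᵥ z) =
      g (τ + 2) + g (-(τ + 2)) + (5 • g τ + 5 • g (-τ)) := by
  have h := congrArg (fun s => (Multiset.map g s).sum) (map_dot_vertices hy)
  simp only [Multiset.map_map] at h
  refine Eq.trans h ?_
  simp
  abel

theorem vertex_dot {y : Fin 3 → ℝ} (hy : y ∈ vertices) : y ⬝ᵥ y = τ + 2 := by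
  have h := Real.goldenRatio_sq
  simp only [vertices, Finset.mem_insert, Finset.mem_singleton] at hy
  rcases hy with rfl | rfl | rfl | rfl | rfl | rfl | rfl | rfl | rfl | rfl | rfl | rfl <;>
    · simp [dotProduct, Fin.sum_univ_three]
      linear_combination h

/-- The reflections move a vertex `y` to the ten vertices other than `±y`, each once. -/
theorem sum_roots_reflection {M : Type*} [AddCommGroup M] [Module ℝ M] {y : Fin 3 → ℝ}
    (hy : y ∈ vertices) (i : Fin 3) (g : (Fin 3 → ℝ) → M) :
    ∑ v ∈ posRoots, ((y ⬝ᵥ v) / 2 * v i) • g (reflection v y) =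
      ∑ z ∈ vertices, (y i - z i) • g z - (2 * y i) • g (-y) := by
  have hy' := hy
  rw [vertices_eq, Finset.mem_map] at hy
  obtain ⟨b, hb, rfl⟩ := hy
  have hterm : ∀ v ∈ posRoots, ((goldenVec b ⬝ᵥ v) / 2 * v i) =
      goldenVec b i - reflection v (goldenVec b) i := by
    intro v hv
    rw [reflection_root hv]
    simp
  change ∑ v ∈ posRoots, ((goldenVec b ⬝ᵥ v) / 2 * v i) • g (reflection v (goldenVec b)) =
      ∑ z ∈ vertices, (goldenVec b i - z i) • g z - (2 * goldenVec b i) • g (-goldenVec b)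
  rw [posRoots_eq, Finset.sum_map]
  have h1 : ∑ v ∈ rootCodes, ((goldenVec b ⬝ᵥ goldenVec v) / 2 * goldenVec v i) •
        g (reflection (goldenVec v) (goldenVec b)) =
      ∑ v ∈ rootCodes.filter fun v => goldenDot b v ≠ 0,
        (fun z => (goldenVec b i - goldenVec z i) • g (goldenVec z)) (goldenReflect v b) := by
    rw [Finset.sum_filter]
    refine Finset.sum_congr rfl fun v hv => ?_
    split_ifs with h0
    · simp only [goldenVec_reflect hv (vertexCodes_even v hv b hb)]
      rw [hterm _ (by rw [posRoots_eq]; exact Finset.mem_map_of_mem _ hv)]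
    · rw [← goldenVal_dot, not_not.1 h0]
      simp [goldenVal]
  refine Eq.trans h1 ?_
  have h2 := congrArg (fun s => (Multiset.map
    (fun z => (goldenVec b i - goldenVec z i) • g (goldenVec z)) s).sum) (goldenReflect_orbit b hb)
  simp only [Multiset.map_map] at h2
  refine Eq.trans h2 ?_
  -- The vertices `±y` are put back into the sum: `y` has coefficient 0, while `-y` has coefficient
  -- `2 y_i` and gives the subtracted term.
  have h3 := Finset.add_sum_erase vertexCodes
    (fun z => (goldenVec b i - goldenVec z i) • g (goldenVec z)) hb
  have h4 := Finset.add_sum_erase (vertexCodes.erase b)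
    (fun z => (goldenVec b i - goldenVec z i) • g (goldenVec z)) (a := -b)
    (Finset.mem_erase.2 ⟨(vertexCodes_neg b hb).2, (vertexCodes_neg b hb).1⟩)
  rw [vertices_eq, Finset.sum_map]
  change Finset.sum _ _ = _
  simp only [Function.Embedding.coeFn_mk]
  rw [← h3, ← h4, goldenVec_neg]
  simp only [Pi.neg_apply, sub_self, zero_smul, zero_add, sub_neg_eq_add, two_mul]
  abel

end Icosahedral
end

noncomputable section
namespace Icosahedral

open MvPolynomial

/-! ### Calculus of the Dunkl operators -/

@[simp] theorem eval_linForm (y x : Fin 3 → ℝ) : eval x (linForm y) = x ⬝ᵥ y := by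
  simp [linForm, dotProduct, mul_comm]

theorem linForm_ne_zero {v : Fin 3 → ℝ} (hv : v ∈ posRoots) : linForm v ≠ 0 := fun h => by
  have h4 := root_dot hv
  rw [← eval_linForm, h] at h4
  simp at h4

theorem linForm_neg (y : Fin 3 → ℝ) : linForm (-y) = -linForm y :=
  MvPolynomial.funext fun x => by simp

theorem pderiv_linForm (i : Fin 3) (y : Fin 3 → ℝ) : pderiv i (linForm y) = C (y i) := by
  simp [linForm, pderiv_X, Pi.single_apply]

theorem linForm_isHomogeneous (y : Fin 3 → ℝ) : (linForm y).IsHomogeneous 1 :=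
  IsHomogeneous.sum _ _ _ fun i _ => by
    simpa using (isHomogeneous_C (Fin 3) (y i)).mul (isHomogeneous_X ℝ i)

theorem radiusSq_isHomogeneous : radiusSq.IsHomogeneous 2 :=
  IsHomogeneous.sum _ _ _ fun i _ => by simpa using (isHomogeneous_X ℝ i).pow 2

/-- The substitution `p ↦ p ∘ σ_v`. -/
def reflPoly (v : Fin 3 → ℝ) : MvPolynomial (Fin 3) ℝ →ₐ[ℝ] MvPolynomial (Fin 3) ℝ :=
  aeval fun i => X i - C (2 / (v ⬝ᵥ v) * v i) * linForm v

theorem eval_reflPoly (v x : Fin 3 → ℝ) (p : MvPolynomial (Fin 3) ℝ) :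
    eval x (reflPoly v p) = eval (reflection v x) p := by
  induction p using MvPolynomial.induction_on with
  | C a => simp [reflPoly]
  | add p q hp hq => simp [hp, hq]
  | mul_X p i hp =>
    rw [map_mul, map_mul, hp, map_mul, eval_X]
    congr 1
    simp [reflPoly, reflection_apply]
    ring

theorem reflPoly_linForm (v y : Fin 3 → ℝ) :
    reflPoly v (linForm y) = linForm (reflection v y) := by
  refine MvPolynomial.funext fun x => ?_
  rw [eval_reflPoly, eval_linForm, eval_linForm]
  simp only [reflection_apply, sub_dotProduct, smul_dotProduct, dotProduct_sub, dotProduct_smul,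
    smul_eq_mul, dotProduct_comm v y]
  ring

theorem linForm_mul_dividedDiff (v : Fin 3 → ℝ) (p : MvPolynomial (Fin 3) ℝ) :
    linForm v * dividedDiff v p = p - reflPoly v p :=
  MvPolynomial.funext fun x => by
    rw [map_mul, eval_linForm, dividedDiff_spec, map_sub, eval_reflPoly]

/-- Polynomials form a domain and the linear form of a root is nonzero, so the defining equation
determines the quotient that was obtained by choice. -/
theorem dividedDiff_eq {v : Fin 3 → ℝ} (hv : v ∈ posRoots) {p q : MvPolynomial (Fin 3) ℝ}
    (h : linForm v * q = p - reflPoly v p) : dividedDiff v p = q :=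
  mul_left_cancel₀ (linForm_ne_zero hv) ((linForm_mul_dividedDiff v p).trans h.symm)

theorem dividedDiff_add {v : Fin 3 → ℝ} (hv : v ∈ posRoots) (p q : MvPolynomial (Fin 3) ℝ) :
    dividedDiff v (p + q) = dividedDiff v p + dividedDiff v q :=
  dividedDiff_eq hv (by rw [mul_add, linForm_mul_dividedDiff, linForm_mul_dividedDiff, map_add]; ring)

theorem dividedDiff_smul {v : Fin 3 → ℝ} (hv : v ∈ posRoots) (a : ℝ)
    (p : MvPolynomial (Fin 3) ℝ) : dividedDiff v (a • p) = a • dividedDiff v p :=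
  dividedDiff_eq hv (by rw [mul_smul_comm, linForm_mul_dividedDiff, map_smul, smul_sub])

theorem dividedDiff_mul {v : Fin 3 → ℝ} (hv : v ∈ posRoots) (p q : MvPolynomial (Fin 3) ℝ) :
    dividedDiff v (p * q) = p * dividedDiff v q + q * dividedDiff v p -
      linForm v * dividedDiff v p * dividedDiff v q :=
  dividedDiff_eq hv (by
    have hp := linForm_mul_dividedDiff v p
    have hq := linForm_mul_dividedDiff v q
    rw [map_mul]
    linear_combination (p - linForm v * dividedDiff v p) * hq + reflPoly v q * hp)

theorem dividedDiff_eq_zero {v : Fin 3 → ℝ} (hv : v ∈ posRoots) {p : MvPolynomial (Fin 3) ℝ}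
    (h : reflPoly v p = p) : dividedDiff v p = 0 :=
  dividedDiff_eq hv (by rw [h, sub_self, mul_zero])

theorem dividedDiff_X {v : Fin 3 → ℝ} (hv : v ∈ posRoots) (i : Fin 3) :
    dividedDiff v (X i) = C (v i / 2) :=
  dividedDiff_eq hv (by
    rw [reflPoly, aeval_X, sub_sub_cancel, mul_comm, root_dot hv]
    congr 2; ring)

theorem reflPoly_radiusSq (v : Fin 3 → ℝ) (hv : v ∈ posRoots) :
    reflPoly v radiusSq = radiusSq := by
  refine MvPolynomial.funext fun x => ?_
  have h := root_dot hv
  rw [eval_reflPoly, reflection_root hv]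
  simp only [dotProduct, Fin.sum_univ_three] at h
  simp [radiusSq, Fin.sum_univ_three, dotProduct]
  linear_combination ((x 0 * v 0 + x 1 * v 1 + x 2 * v 2) / 2) ^ 2 * h

/-- The Dunkl operators are linear. -/
def dunklLin (κ : ℝ) (i : Fin 3) : MvPolynomial (Fin 3) ℝ →ₗ[ℝ] MvPolynomial (Fin 3) ℝ where
  toFun := dunkl κ i
  map_add' p q := by
    simp only [dunkl, map_add]
    rw [Finset.sum_congr rfl fun v hv => by rw [dividedDiff_add hv p q, mul_add],
      Finset.sum_add_distrib]
    ring
  map_smul' a p := by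
    simp only [dunkl, RingHom.id_apply, Derivation.map_smul, smul_add, Finset.smul_sum]
    rw [Finset.sum_congr rfl fun v hv => by rw [dividedDiff_smul hv a p, mul_smul_comm]]

theorem dunklLin_apply (κ : ℝ) (i : Fin 3) (p : MvPolynomial (Fin 3) ℝ) :
    dunklLin κ i p = dunkl κ i p := rfl

/-- The correction to the Leibniz rule vanishes if one factor is invariant, and each of its terms is
odd under `σ_v`; the latter makes it disappear under the integral. -/
theorem dunkl_mul (κ : ℝ) (i : Fin 3) (p q : MvPolynomial (Fin 3) ℝ) :
    dunkl κ i (p * q) = p * dunkl κ i q + q * dunkl κ i p -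
      ∑ v ∈ posRoots, C (κ * v i) * (linForm v * dividedDiff v p * dividedDiff v q) := by
  simp only [dunkl, Derivation.leibniz, smul_eq_mul, mul_add, Finset.mul_sum]
  rw [Finset.sum_congr rfl fun v hv => by rw [dividedDiff_mul hv p q, mul_sub, mul_add],
    Finset.sum_sub_distrib, Finset.sum_add_distrib]
  simp only [mul_left_comm p, mul_left_comm q]
  ring

theorem dunkl_C (κ : ℝ) (i : Fin 3) (a : ℝ) : dunkl κ i (C a) = 0 := by
  rw [dunkl, pderiv_C, zero_add]
  refine Finset.sum_eq_zero fun v hv => ?_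
  rw [dividedDiff_eq_zero hv (by simp [reflPoly]), mul_zero]

theorem dunkl_radiusSq_mul (κ : ℝ) (i : Fin 3) (p : MvPolynomial (Fin 3) ℝ) :
    dunkl κ i (radiusSq * p) = radiusSq * dunkl κ i p + 2 * X i * p := by
  have h0 : ∀ v ∈ posRoots, dividedDiff v radiusSq = 0 := fun v hv =>
    dividedDiff_eq_zero hv (reflPoly_radiusSq v hv)
  have h1 : dunkl κ i radiusSq = 2 * X i := by
    rw [dunkl, Finset.sum_eq_zero fun v hv => by rw [h0 v hv, mul_zero]]
    simp [radiusSq, pderiv_X, Pi.single_apply, Derivation.leibniz_pow, two_mul]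
  rw [dunkl_mul, h1, Finset.sum_eq_zero fun v hv => by rw [h0 v hv]; simp]
  ring

/-- Contracting `v_i` with `x_i` produces `⟨x, v⟩`, which cancels the denominator of the difference
quotient. -/
theorem sum_X_mul_dunkl (κ : ℝ) (p : MvPolynomial (Fin 3) ℝ) :
    ∑ i, X i * dunkl κ i p = ∑ i, X i * pderiv i p +
      ∑ v ∈ posRoots, C κ * (p - reflPoly v p) := by
  simp only [dunkl, mul_add, Finset.sum_add_distrib, Finset.mul_sum]
  rw [Finset.sum_comm]
  congr 1
  refine Finset.sum_congr rfl fun v _ => ?_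
  rw [← linForm_mul_dividedDiff, linForm, Finset.sum_mul, Finset.mul_sum]
  refine Finset.sum_congr rfl fun i _ => ?_
  rw [C_mul]; ring

theorem sum_dunkl_X_mul (κ : ℝ) (p : MvPolynomial (Fin 3) ℝ) :
    ∑ i, dunkl κ i (X i * p) = ∑ i, X i * dunkl κ i p + C (3 + 30 * κ) * p -
      ∑ v ∈ posRoots, C (2 * κ) * (p - reflPoly v p) := by
  have hX : ∑ i, dunkl κ i (X i) = C (3 + 30 * κ) := by
    have : ∀ i, dunkl κ i (X i) = C (1 + ∑ v ∈ posRoots, κ * v i * (v i / 2)) := fun i => by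
      rw [dunkl, Finset.sum_congr rfl fun v hv => by rw [dividedDiff_X hv i, ← C_mul]]
      simp
    rw [Finset.sum_congr rfl fun i _ => this i, ← map_sum, Finset.sum_add_distrib,
      Finset.sum_comm]
    -- Each root has squared length 4 and contributes `2κ`; the fifteen of them give the `30κ`.
    have h2 : ∀ v ∈ posRoots, ∑ i, κ * v i * (v i / 2) = 2 * κ := fun v hv => by
      have h := root_dot hv
      simp only [dotProduct, Fin.sum_univ_three] at h ⊢
      linear_combination κ / 2 * h
    rw [Finset.sum_congr rfl h2, Finset.sum_const, Finset.sum_const, card_posRoots]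
    congr 1
    simp; ring
  have h3 : ∑ i, ∑ v ∈ posRoots, C (κ * v i) *
        (linForm v * dividedDiff v (X i) * dividedDiff v p) =
      ∑ v ∈ posRoots, C (2 * κ) * (p - reflPoly v p) := by
    rw [Finset.sum_comm]
    refine Finset.sum_congr rfl fun v hv => ?_
    have h := root_dot hv
    rw [← linForm_mul_dividedDiff]
    have h4 : ∑ i, κ * v i * (v i / 2) = 2 * κ := by
      simp only [dotProduct, Fin.sum_univ_three] at h ⊢
      linear_combination κ / 2 * h
    rw [← h4, map_sum, Finset.sum_mul]
    refine Finset.sum_congr rfl fun i _ => ?_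
    rw [dividedDiff_X hv, C_mul (a := κ * v i)]; ring
  simp only [dunkl_mul, Finset.sum_add_distrib, Finset.sum_sub_distrib]
  rw [h3, ← Finset.mul_sum, hX]
  ring

/-- The reflection terms of `sum_X_mul_dunkl` and `sum_dunkl_X_mul` cancel, so the commutator of
`Δ_κ` with `|x|²` is a scalar on each degree, even without invariance. -/
theorem dunklLaplacian_radiusSq_mul (κ : ℝ) {p : MvPolynomial (Fin 3) ℝ} {d : ℕ}
    (hp : p.IsHomogeneous d) : dunklLaplacian κ (radiusSq * p) =
      radiusSq * dunklLaplacian κ p + C (2 * (2 * d + 3 + 30 * κ)) * p := by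
  have two : (C (2 : ℝ) : MvPolynomial (Fin 3) ℝ) = 2 := map_ofNat C 2
  have h2 : ∀ i, dunkl κ i (2 * X i * p) = 2 * dunkl κ i (X i * p) := fun i => by
    have := (dunklLin κ i).map_smul 2 (X i * p)
    rw [smul_eq_C_mul, smul_eq_C_mul, ← mul_assoc] at this
    simpa only [dunklLin_apply, two] using this
  have h1 : ∀ i, dunkl κ i (dunkl κ i (radiusSq * p)) = radiusSq * dunkl κ i (dunkl κ i p) +
      2 * (X i * dunkl κ i p) + 2 * dunkl κ i (X i * p) := fun i => by
    rw [dunkl_radiusSq_mul, ← dunklLin_apply, map_add, dunklLin_apply, dunklLin_apply,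
      dunkl_radiusSq_mul, h2]
    ring
  simp only [dunklLaplacian, h1, Finset.sum_add_distrib, ← Finset.mul_sum]
  rw [sum_dunkl_X_mul, sum_X_mul_dunkl, hp.sum_X_mul_pderiv]
  simp only [← Finset.mul_sum, C_mul, C_add, nsmul_eq_mul]
  rw [show (C (d : ℝ) : MvPolynomial (Fin 3) ℝ) = d by simp, two]
  ring

theorem dunklLaplacian_radiusSq_pow_mul (κ : ℝ) {p : MvPolynomial (Fin 3) ℝ} {d : ℕ}
    (hp : p.IsHomogeneous d) (j : ℕ) : dunklLaplacian κ (radiusSq ^ (j + 1) * p) =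
      radiusSq ^ (j + 1) * dunklLaplacian κ p +
        C (4 * (j + 1) * (j + d + 3 / 2 + 15 * κ)) * (radiusSq ^ j * p) := by
  induction j with
  | zero =>
    rw [zero_add, pow_one, dunklLaplacian_radiusSq_mul κ hp]
    simp only [pow_zero, one_mul]
    congr 3
    push_cast; ring
  | succ j ih =>
    have hh : (radiusSq ^ (j + 1) * p).IsHomogeneous (2 * (j + 1) + d) :=
      (radiusSq_isHomogeneous.pow _).mul hp
    have hc : (4 * ((j + 1 : ℕ) + 1) * ((j + 1 : ℕ) + d + 3 / 2 + 15 * κ) : ℝ) =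
        4 * (j + 1) * (j + d + 3 / 2 + 15 * κ) +
          2 * (2 * (2 * (j + 1) + d : ℕ) + 3 + 30 * κ) := by
      push_cast; ring
    rw [hc, C_add, show radiusSq ^ (j + 1 + 1) * p = radiusSq * (radiusSq ^ (j + 1) * p) by ring,
      dunklLaplacian_radiusSq_mul κ hh, ih]
    ring

/-! ### Degree bounds for the Dunkl operators. -/

theorem totalDegree_reflPoly_le (v : Fin 3 → ℝ) (p : MvPolynomial (Fin 3) ℝ) :
    (reflPoly v p).totalDegree ≤ p.totalDegree := by
  have hlin : ∀ i, (X i - C (2 / (v ⬝ᵥ v) * v i) * linForm v :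
      MvPolynomial (Fin 3) ℝ).IsHomogeneous 1 := fun i =>
    (isHomogeneous_X ℝ i).sub (by
      simpa using (isHomogeneous_C (Fin 3) (2 / (v ⬝ᵥ v) * v i)).mul (linForm_isHomogeneous v))
  rw [reflPoly, aeval_def, eval₂_eq]
  refine totalDegree_finsetSum_le fun m hm => ?_
  refine le_trans ?_ (le_totalDegree hm)
  refine (totalDegree_mul _ _).trans ?_
  simp only [algebraMap_eq, totalDegree_C, zero_add]
  refine (totalDegree_finsetProd _ _).trans ?_
  exact Finset.sum_le_sum fun i _ => (totalDegree_pow _ _).trans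
    (by simpa using Nat.mul_le_mul_left (m i) (hlin i).totalDegree_le)

theorem totalDegree_dividedDiff_le {v : Fin 3 → ℝ} (hv : v ∈ posRoots)
    (p : MvPolynomial (Fin 3) ℝ) : (dividedDiff v p).totalDegree ≤ p.totalDegree - 1 := by
  by_cases h0 : dividedDiff v p = 0
  · simp [h0]
  have h1 := totalDegree_mul_of_isDomain (linForm_ne_zero hv) h0
  rw [linForm_mul_dividedDiff, (linForm_isHomogeneous v).totalDegree (linForm_ne_zero hv)] at h1
  have h2 := (totalDegree_sub p (reflPoly v p)).trans (max_le le_rfl (totalDegree_reflPoly_le v p))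
  omega

theorem totalDegree_dunkl_le (κ : ℝ) (i : Fin 3) (p : MvPolynomial (Fin 3) ℝ) :
    (dunkl κ i p).totalDegree ≤ p.totalDegree - 1 := by
  refine (totalDegree_add _ _).trans (max_le ?_ ?_)
  · conv_lhs => rw [← sum_homogeneousComponent p, map_sum]
    refine totalDegree_finsetSum_le fun k hk => ?_
    have := (homogeneousComponent_isHomogeneous k p).pderiv (i := i)
    have := this.totalDegree_le
    have := Finset.mem_range.1 hk
    omega
  · refine totalDegree_finsetSum_le fun v hv => ?_
    refine (totalDegree_mul _ _).trans ?_
    rw [totalDegree_C, zero_add]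
    exact totalDegree_dividedDiff_le hv p

end Icosahedral
end

noncomputable section
namespace Icosahedral

open MvPolynomial

/-! ### Binomial series -/

theorem poch_zero (a : ℝ) : poch a 0 = 1 := by simp [poch]

theorem poch_succ (a : ℝ) (n : ℕ) : poch a (n + 1) = poch a n * (a + n) := by
  simp [poch, ascPochhammer_succ_right]

theorem poch_succ_left (a : ℝ) (n : ℕ) : poch a (n + 1) = a * poch (a + 1) n := by
  simp [poch, ascPochhammer_succ_left, Polynomial.eval_comp]

theorem poch_one (n : ℕ) : poch 1 n = n.factorial := by
  simp [poch, ascPochhammer_eval_one]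

theorem poch_pos {a : ℝ} (ha : 0 < a) (n : ℕ) : 0 < poch a n :=
  ascPochhammer_pos n a ha

variable {A : Type*} [CommRing A] [Algebra ℝ A]

/-- The power series `(1 - a X)^{-s}` over an `ℝ`-algebra. -/
def binomSeries (s : ℝ) (a : A) : PowerSeries A :=
  PowerSeries.mk fun m => algebraMap ℝ A (poch s m / (m.factorial : ℝ)) * a ^ m

theorem coeff_binomSeries (s : ℝ) (a : A) (m : ℕ) : PowerSeries.coeff m (binomSeries s a) =
    algebraMap ℝ A (poch s m / (m.factorial : ℝ)) * a ^ m := PowerSeries.coeff_mk _ _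

theorem coeff_zero_binomSeries (s : ℝ) (a : A) :
    PowerSeries.coeff 0 (binomSeries s a) = 1 := by
  simp [coeff_binomSeries, poch_zero]

theorem map_binomSeries {B : Type*} [CommRing B] [Algebra ℝ B] (f : A →ₐ[ℝ] B) (s : ℝ) (a : A) :
    PowerSeries.map (f : A →+* B) (binomSeries s a) = binomSeries s (f a) := by
  ext m
  simp [coeff_binomSeries]

theorem one_sub_mul_binomSeries (s : ℝ) (a : A) :
    (1 - PowerSeries.C a * PowerSeries.X) * binomSeries (s + 1) a = binomSeries s a := by
  ext m
  rw [sub_mul, one_mul, mul_assoc, map_sub, PowerSeries.coeff_C_mul]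
  cases m with
  | zero => simp [coeff_zero_binomSeries]
  | succ m =>
    rw [PowerSeries.coeff_succ_X_mul]
    simp only [coeff_binomSeries]
    rw [pow_succ', mul_left_comm a, ← sub_mul, ← map_sub, poch_succ, poch_succ_left,
      Nat.factorial_succ]
    congr 2
    have : (m.factorial : ℝ) ≠ 0 := by positivity
    push_cast
    field_simp
    ring

theorem one_sub_mul_binomSeries_one (a : A) :
    (1 - PowerSeries.C a * PowerSeries.X) * binomSeries 1 a = 1 := by
  have := one_sub_mul_binomSeries 0 a
  rw [zero_add] at this
  rw [this]
  ext m
  cases m with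
  | zero => simp [coeff_zero_binomSeries]
  | succ m => simp [coeff_binomSeries, poch_succ_left, PowerSeries.coeff_one]

theorem binomSeries_succ (s : ℝ) (a : A) :
    binomSeries (s + 1) a = binomSeries s a * binomSeries 1 a := by
  rw [← one_sub_mul_binomSeries s a]
  linear_combination (-binomSeries (s + 1) a) * one_sub_mul_binomSeries_one a

theorem X_mul_binomSeries_one (a : A) :
    PowerSeries.C a * PowerSeries.X * binomSeries 1 a = binomSeries 1 a - 1 := by
  linear_combination -one_sub_mul_binomSeries_one a

/-- The Euler operator `X d/dX` on power series. -/
def eulerDeriv (A : Type*) [CommRing A] [Algebra ℝ A] :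
    Derivation ℝ (PowerSeries A) (PowerSeries A) :=
  Derivation.mk'
    { toFun := fun f => PowerSeries.mk fun n => (n : A) * PowerSeries.coeff n f
      map_add' := fun f g => by ext n; simp [mul_add]
      map_smul' := fun a f => by ext n; simp }
    fun f g => by
      ext n
      simp only [LinearMap.coe_mk, AddHom.coe_mk, PowerSeries.coeff_mk, smul_eq_mul, map_add]
      rw [mul_comm g, PowerSeries.coeff_mul, PowerSeries.coeff_mul, PowerSeries.coeff_mul,
        ← Finset.sum_add_distrib, Finset.mul_sum]
      refine Finset.sum_congr rfl fun p hp => ?_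
      rw [← Finset.HasAntidiagonal.mem_antidiagonal.1 hp]
      simp only [PowerSeries.coeff_mk]
      push_cast; ring

theorem coeff_eulerDeriv (f : PowerSeries A) (n : ℕ) :
    PowerSeries.coeff n (eulerDeriv A f) = (n : A) * PowerSeries.coeff n f :=
  PowerSeries.coeff_mk n fun n => (n : A) * PowerSeries.coeff n f

/-- The logarithmic derivative of `(1 - aX)^{-s}` is `s aX / (1 - aX)`; in this form, products of
binomial series reduce to sums of geometric series. -/
theorem eulerDeriv_binomSeries (s : ℝ) (a : A) :
    eulerDeriv A (binomSeries s a) = binomSeries s a * (s • (binomSeries 1 a - 1)) := by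
  rw [← X_mul_binomSeries_one, mul_smul_comm, mul_left_comm, mul_assoc, ← binomSeries_succ]
  ext m
  rw [coeff_eulerDeriv, PowerSeries.coeff_smul, PowerSeries.coeff_C_mul]
  cases m with
  | zero => simp
  | succ m =>
    rw [PowerSeries.coeff_succ_X_mul]
    simp only [coeff_binomSeries]
    rw [pow_succ', mul_left_comm a, ← smul_mul_assoc, ← mul_assoc, Algebra.smul_def, ← map_mul,
      ← map_natCast (algebraMap ℝ A), ← map_mul, poch_succ_left, Nat.factorial_succ]
    congr 2
    have : (m.factorial : ℝ) ≠ 0 := by positivity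
    push_cast
    field_simp

/-- Logarithmic derivatives of the factors of a product add up. -/
theorem derivation_prod_of_logDeriv {R : Type*} [CommRing R] [Algebra ℝ R] (δ : Derivation ℝ R R)
    {ι : Type*} (s : Finset ι) (f g : ι → R) (h : ∀ i ∈ s, δ (f i) = f i * g i) :
    δ (∏ i ∈ s, f i) = (∏ i ∈ s, f i) * ∑ i ∈ s, g i := by
  classical
  induction s using Finset.induction_on with
  | empty => simp
  | insert a s ha ih =>
    rw [Finset.prod_insert ha, Finset.sum_insert ha, Derivation.leibniz,
      ih fun i hi => h i (Finset.mem_insert_of_mem hi), h a (Finset.mem_insert_self a s)]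
    simp only [smul_eq_mul]
    ring

theorem derivation_mul_of_logDeriv {R : Type*} [CommRing R] [Algebra ℝ R] (δ : Derivation ℝ R R)
    {f₁ f₂ g₁ g₂ : R} (h₁ : δ f₁ = f₁ * g₁) (h₂ : δ f₂ = f₂ * g₂) :
    δ (f₁ * f₂) = f₁ * f₂ * (g₁ + g₂) := by
  rw [Derivation.leibniz, h₁, h₂]
  simp only [smul_eq_mul]
  ring

/-- As `g` has no constant term, the equation is a recursion expressing `n f_n` through earlier
coefficients. Products of binomial series can thus be compared through their logarithmic
derivatives. -/
theorem eq_of_eulerDeriv_eq {f₁ f₂ g : PowerSeries ℝ} (h₁ : eulerDeriv ℝ f₁ = f₁ * g)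
    (h₂ : eulerDeriv ℝ f₂ = f₂ * g) (hg : PowerSeries.coeff 0 g = 0)
    (h0 : PowerSeries.coeff 0 f₁ = PowerSeries.coeff 0 f₂) : f₁ = f₂ := by
  have key : ∀ n, PowerSeries.coeff n f₁ = PowerSeries.coeff n f₂ := by
    intro n
    induction n using Nat.strong_induction_on with
    | _ n ih =>
      rcases Nat.eq_zero_or_pos n with rfl | hn
      · exact h0
      have e₁ := congrArg (PowerSeries.coeff n) h₁
      have e₂ := congrArg (PowerSeries.coeff n) h₂
      rw [coeff_eulerDeriv, PowerSeries.coeff_mul] at e₁ e₂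
      have hn' : (n : ℝ) ≠ 0 := by positivity
      refine mul_left_cancel₀ hn' (e₁.trans (Eq.trans ?_ e₂.symm))
      refine Finset.sum_congr rfl fun p hp => ?_
      have hp' := Finset.HasAntidiagonal.mem_antidiagonal.1 hp
      rcases Nat.eq_zero_or_pos p.2 with h | h
      · rw [h, hg, mul_zero, mul_zero]
      · rw [ih p.1 (by omega)]
  exact PowerSeries.ext key

/-! ### The Dunkl operators on the generating function -/

/-- Coefficientwise partial derivative of a power series over `ℝ[x]`. -/
def coeffPderiv (i : Fin 3) : Derivation ℝ (PowerSeries (MvPolynomial (Fin 3) ℝ))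
    (PowerSeries (MvPolynomial (Fin 3) ℝ)) :=
  Derivation.mk'
    { toFun := fun f => PowerSeries.mk fun n => pderiv i (PowerSeries.coeff n f)
      map_add' := fun f g => by ext1 n; simp
      map_smul' := fun a f => by ext1 n; simp }
    fun f g => by
      ext1 n
      simp only [LinearMap.coe_mk, AddHom.coe_mk, PowerSeries.coeff_mk, smul_eq_mul, map_add]
      rw [mul_comm g, PowerSeries.coeff_mul, PowerSeries.coeff_mul, PowerSeries.coeff_mul,
        ← Finset.sum_add_distrib, map_sum]
      refine Finset.sum_congr rfl fun p _ => ?_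
      simp only [PowerSeries.coeff_mk, Derivation.leibniz, smul_eq_mul]
      ring

theorem coeff_coeffPderiv (i : Fin 3) (f : PowerSeries (MvPolynomial (Fin 3) ℝ)) (n : ℕ) :
    PowerSeries.coeff n (coeffPderiv i f) = pderiv i (PowerSeries.coeff n f) :=
  PowerSeries.coeff_mk n fun n => pderiv i (PowerSeries.coeff n f)

theorem coeffPderiv_binomSeries (i : Fin 3) (s : ℝ) (y : Fin 3 → ℝ) :
    coeffPderiv i (binomSeries s (linForm y)) =
      binomSeries s (linForm y) * ((s * y i) • (PowerSeries.X * binomSeries 1 (linForm y))) := by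
  rw [mul_smul_comm, mul_left_comm, ← binomSeries_succ]
  ext1 m
  rw [coeff_coeffPderiv, PowerSeries.coeff_smul]
  cases m with
  | zero => simp [coeff_binomSeries]
  | succ m =>
    rw [PowerSeries.coeff_succ_X_mul]
    simp only [coeff_binomSeries, algebraMap_eq]
    rw [Derivation.leibniz, pderiv_C, Derivation.leibniz_pow, pderiv_linForm, smul_zero, add_zero,
      poch_succ_left, Nat.factorial_succ, smul_eq_C_mul]
    have h : (s * y i) * (poch (s + 1) m / (m.factorial : ℝ)) =
        (s * poch (s + 1) m / ((m + 1 : ℕ) * m.factorial : ℕ)) * ((m + 1 : ℕ) * y i) := by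
      have : (m.factorial : ℝ) ≠ 0 := by positivity
      push_cast
      field_simp
    rw [← mul_assoc, ← C_mul, h]
    simp
    ring

/-- The invariant factor `∏_y (1 - r⟨x, y⟩)^{-κ}` of the generating function. -/
def invFun (κ : ℝ) : PowerSeries (MvPolynomial (Fin 3) ℝ) :=
  ∏ y ∈ vertices, binomSeries κ (linForm y)

theorem genFun_eq (κ : ℝ) (y : Fin 3 → ℝ) :
    genFun κ y = binomSeries 1 (linForm y) * invFun κ := rfl

theorem map_reflPoly_invFun (κ : ℝ) {v : Fin 3 → ℝ} (hv : v ∈ posRoots) :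
    PowerSeries.map (reflPoly v : _ →+* _) (invFun κ) = invFun κ := by
  rw [invFun, map_prod]
  simp only [map_binomSeries, reflPoly_linForm]
  refine Finset.prod_bij' (fun y _ => reflection v y) (fun y _ => reflection v y)
    (fun y hy => reflection_mem_vertices hv hy) (fun y hy => reflection_mem_vertices hv hy)
    ?_ ?_ fun _ _ => rfl
  all_goals
    intro y _
    exact (reflection v).left_inv y

theorem map_reflPoly_genFun (κ : ℝ) {v : Fin 3 → ℝ} (hv : v ∈ posRoots) (y : Fin 3 → ℝ) :
    PowerSeries.map (reflPoly v : _ →+* _) (genFun κ y) = genFun κ (reflection v y) := by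
  rw [genFun_eq, map_mul, map_reflPoly_invFun κ hv, map_binomSeries, reflPoly_linForm, genFun_eq]

theorem reflPoly_q (κ : ℝ) (n : ℕ) {v : Fin 3 → ℝ} (hv : v ∈ posRoots) (y : Fin 3 → ℝ) :
    reflPoly v (q κ n y) = q κ n (reflection v y) := by
  rw [q, q, ← map_reflPoly_genFun κ hv, PowerSeries.coeff_map]
  rfl

/-- Only the pole at `y` is moved by `σ_v`, and `1/(1 - ra) - 1/(1 - rb) = r(a - b) / ((1 - ra)(1 -
rb))` with `a = ⟨x, y⟩`, `b = ⟨x, σ_v y⟩`. -/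
theorem dividedDiff_q (κ : ℝ) (n : ℕ) {v : Fin 3 → ℝ} (hv : v ∈ posRoots) (y : Fin 3 → ℝ) :
    dividedDiff v (q κ n y) = PowerSeries.coeff n (((y ⬝ᵥ v) / 2) •
      (PowerSeries.X * (genFun κ y * binomSeries 1 (linForm (reflection v y))))) := by
  refine dividedDiff_eq hv ?_
  rw [reflPoly_q κ n hv, q, q, ← map_sub, ← PowerSeries.coeff_C_mul]
  congr 1
  have h1 := one_sub_mul_binomSeries_one (linForm y)
  have h2 := one_sub_mul_binomSeries_one (linForm (reflection v y))
  -- `y - σ_v y = (⟨y, v⟩ / 2) v`, because `|v|² = 4`.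
  have h3 : (PowerSeries.C (linForm v) : PowerSeries (MvPolynomial (Fin 3) ℝ)) *
      PowerSeries.C (C ((y ⬝ᵥ v) / 2)) =
      PowerSeries.C (linForm y) - PowerSeries.C (linForm (reflection v y)) := by
    rw [← map_mul, ← map_sub]
    congr 1
    refine MvPolynomial.funext fun x => ?_
    rw [reflection_root hv]
    simp only [map_mul, map_sub, eval_linForm, eval_C, dotProduct_sub, dotProduct_smul, smul_eq_mul]
    ring
  rw [genFun_eq, genFun_eq]
  have h4 : ∀ (a : ℝ) (f : PowerSeries (MvPolynomial (Fin 3) ℝ)),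
      a • f = PowerSeries.C (C a) * f := fun a f => by
    ext1 n
    rw [PowerSeries.coeff_smul, PowerSeries.coeff_C_mul, smul_eq_C_mul]
  rw [h4]
  set a := binomSeries 1 (linForm y)
  set b := binomSeries 1 (linForm (reflection v y))
  linear_combination (PowerSeries.X * a * invFun κ * b) * h3 - (invFun κ * b) * h1 +
    (invFun κ * a) * h2

/-- The substitution `r ↦ -r` exchanges `y` with `-y` and permutes the factors of the invariant
product. -/
theorem q_neg (κ : ℝ) (n : ℕ) (y : Fin 3 → ℝ) : q κ n (-y) = (-1) ^ n * q κ n y := by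
  have hb : ∀ (s : ℝ) (z : Fin 3 → ℝ), PowerSeries.rescale (-1) (binomSeries s (linForm z)) =
      binomSeries s (linForm (-z)) := fun s z => by
    ext1 m
    rw [PowerSeries.coeff_rescale, coeff_binomSeries, coeff_binomSeries, linForm_neg, neg_pow]
    ring
  have hP : PowerSeries.rescale (-1) (invFun κ) = invFun κ := by
    rw [invFun, map_prod]
    simp only [hb]
    exact Finset.prod_bij' (fun y _ => -y) (fun y _ => -y) (fun y hy => neg_mem_vertices hy)
      (fun y hy => neg_mem_vertices hy) (fun y _ => neg_neg y) (fun y _ => neg_neg y)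
      fun _ _ => rfl
  rw [q, q, ← PowerSeries.coeff_rescale, genFun_eq, genFun_eq,
    (PowerSeries.rescale (-1 : MvPolynomial (Fin 3) ℝ)).map_mul, hb, hP]

theorem q_zero (κ : ℝ) (y : Fin 3 → ℝ) : q κ 0 y = 1 := by
  rw [q, genFun_eq, invFun, PowerSeries.coeff_zero_eq_constantCoeff_apply, map_mul, map_prod]
  simp only [← PowerSeries.coeff_zero_eq_constantCoeff_apply, coeff_zero_binomSeries]
  simp

theorem q_isHomogeneous (κ : ℝ) (n : ℕ) (y : Fin 3 → ℝ) : (q κ n y).IsHomogeneous n := by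
  have hb : ∀ (s : ℝ) (z : Fin 3 → ℝ) (m : ℕ),
      (PowerSeries.coeff m (binomSeries s (linForm z))).IsHomogeneous m := fun s z m => by
    rw [coeff_binomSeries]
    simpa using (isHomogeneous_C (Fin 3) (poch s m / (m.factorial : ℝ))).mul
      ((linForm_isHomogeneous z).pow m)
  have hmul : ∀ f g : PowerSeries (MvPolynomial (Fin 3) ℝ),
      (∀ m, (PowerSeries.coeff m f).IsHomogeneous m) →
      (∀ m, (PowerSeries.coeff m g).IsHomogeneous m) →
      ∀ m, (PowerSeries.coeff m (f * g)).IsHomogeneous m := fun f g hf hg m => by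
    rw [PowerSeries.coeff_mul]
    refine IsHomogeneous.sum _ _ _ fun p hp => ?_
    rw [← Finset.HasAntidiagonal.mem_antidiagonal.1 hp]
    exact (hf p.1).mul (hg p.2)
  have hprod : ∀ m, (PowerSeries.coeff m (invFun κ)).IsHomogeneous m :=
    Finset.prod_induction _ (fun f : PowerSeries (MvPolynomial (Fin 3) ℝ) =>
      ∀ m, (PowerSeries.coeff m f).IsHomogeneous m) hmul
      (fun m => by
        rw [PowerSeries.coeff_one]
        split_ifs with h
        · subst h; exact isHomogeneous_one _ _
        · exact isHomogeneous_zero _ _ _)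
      fun y _ => hb κ y
  exact hmul _ _ (hb 1 y) hprod n

/-! ### The constants `ν(n)` and the lowering relation. -/

theorem nu_zero (κ : ℝ) : nu κ 0 = 1 := by simp [nu, poch_zero]

theorem nu_pos {κ : ℝ} (hκ : 0 < κ) (n : ℕ) : 0 < nu κ n := by
  have := poch_pos (show 0 < 6 * κ + 1 by positivity) (n / 2)
  have := poch_pos (show 0 < 5 * κ + 1 / 2 by positivity) ((n + 1) / 2)
  unfold nu; positivity

/-- The ratio is `n + 1 + 10κ` for even `n` and `n + 1 + 12κ` for odd `n`: exactly the factor that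
the Dunkl operators produce on `q_{n+1}`. -/
theorem nu_succ (κ : ℝ) (n : ℕ) :
    nu κ (n + 1) = (n + 1 + 11 * κ - κ * (-1) ^ n) * nu κ n := by
  rcases Nat.even_or_odd' n with ⟨k, rfl | rfl⟩
  · rw [nu, nu, show (2 * k + 1) / 2 = k by omega, show (2 * k + 1 + 1) / 2 = k + 1 by omega,
      show 2 * k / 2 = k by omega, poch_succ, pow_mul (-1 : ℝ)]
    simp; ring
  · rw [nu, nu, show (2 * k + 1) / 2 = k by omega, show (2 * k + 1 + 1) / 2 = k + 1 by omega,
      show (2 * k + 1 + 1 + 1) / 2 = k + 1 by omega, poch_succ, pow_succ (-1 : ℝ),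
      pow_mul (-1 : ℝ)]
    simp; ring

/-- The Dunkl operators send `q_{n+1}(·; y)` to multiples of `q_n(·; y)`. -/
theorem dunkl_q_succ (κ : ℝ) (n : ℕ) (i : Fin 3) {y : Fin 3 → ℝ} (hy : y ∈ vertices) :
    dunkl κ i (q κ (n + 1) y) = (y i * (n + 1 + 11 * κ - κ * (-1) ^ n)) • q κ n y := by
  have hF : coeffPderiv i (genFun κ y) = PowerSeries.X * (genFun κ y *
      (y i • binomSeries 1 (linForm y) +
        ∑ z ∈ vertices, (κ * z i) • binomSeries 1 (linForm z))) := by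
    have h := derivation_mul_of_logDeriv (coeffPderiv i) (coeffPderiv_binomSeries i 1 y)
      (derivation_prod_of_logDeriv (coeffPderiv i) vertices
        (fun z => binomSeries κ (linForm z))
        (fun z => (κ * z i) • (PowerSeries.X * binomSeries 1 (linForm z))) fun z _ => coeffPderiv_binomSeries i κ z)
    rw [genFun_eq, invFun, h, one_mul]
    simp only [← mul_smul_comm, ← Finset.mul_sum]
    ring
  have hθ : eulerDeriv _ (genFun κ y) = genFun κ y * (binomSeries 1 (linForm y) - 1 +
        ∑ z ∈ vertices, κ • (binomSeries 1 (linForm z) - 1)) := by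
    have h := derivation_mul_of_logDeriv (eulerDeriv (MvPolynomial (Fin 3) ℝ)) (eulerDeriv_binomSeries 1 (linForm y))
      (derivation_prod_of_logDeriv (eulerDeriv (MvPolynomial (Fin 3) ℝ)) vertices
        (fun z => binomSeries κ (linForm z))
        (fun z => κ • (binomSeries 1 (linForm z) - 1)) fun z _ => eulerDeriv_binomSeries κ (linForm z))
    rw [genFun_eq, invFun, h, one_smul]
  have hcard : vertices.card = 12 := by
    rw [vertices_eq, Finset.card_map]; rfl
  -- With `a = r⟨x, y⟩`, this is `2 / ((1 - a)(1 + a)) = 1/(1 - a) + 1/(1 + a)`.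
  have hneg : (2 : ℝ) • (genFun κ y * binomSeries 1 (linForm (-y))) =
      genFun κ y + genFun κ (-y) := by
    have h1 := one_sub_mul_binomSeries_one (linForm y)
    have h2 := one_sub_mul_binomSeries_one (linForm (-y))
    rw [genFun_eq, genFun_eq, two_smul]
    rw [linForm_neg, map_neg] at h2
    rw [linForm_neg]
    set a := binomSeries 1 (linForm y)
    set b := binomSeries 1 (-linForm y)
    linear_combination (invFun κ * b) * h1 + (invFun κ * a) * h2
  have hdd : ∑ v ∈ posRoots, C (κ * v i) * dividedDiff v (q κ (n + 1) y) =
      PowerSeries.coeff (n + 1) (PowerSeries.X * (genFun κ y * κ •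
        (∑ z ∈ vertices, (y i - z i) • binomSeries 1 (linForm z) -
          (2 * y i) • binomSeries 1 (linForm (-y))))) := by
    rw [← sum_roots_reflection hy i fun z => binomSeries 1 (linForm z)]
    simp only [Finset.smul_sum, Finset.mul_sum, map_sum]
    refine Finset.sum_congr rfl fun v hv => ?_
    rw [dividedDiff_q κ _ hv, ← smul_eq_C_mul, ← PowerSeries.coeff_smul]
    congr 1
    rw [smul_smul, smul_smul, mul_smul_comm, mul_smul_comm]
    congr 1
    ring
  rw [dunkl, hdd, q, ← coeff_coeffPderiv, hF, ← map_add, ← mul_add, ← mul_add,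
    PowerSeries.coeff_succ_X_mul]
  -- The terms with `z_i` cancel between the derivative and the difference part. The constant `1 +
  -- 12κ` restores the ones subtracted in the logarithmic derivatives: one for the extra pole and
  -- `κ` for each vertex.
  have hsum : genFun κ y * (y i • binomSeries 1 (linForm y) +
        ∑ z ∈ vertices, (κ * z i) • binomSeries 1 (linForm z) + κ •
        (∑ z ∈ vertices, (y i - z i) • binomSeries 1 (linForm z) -
          (2 * y i) • binomSeries 1 (linForm (-y)))) =
      y i • (eulerDeriv _ (genFun κ y) + (1 + 12 * κ) • genFun κ y -
        κ • (genFun κ y + genFun κ (-y))) := by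
    rw [hθ, ← hneg]
    simp only [sub_smul, smul_sub, Finset.sum_sub_distrib, Finset.smul_sum, Finset.sum_const,
      hcard, smul_smul, mul_add, mul_sub, smul_add, mul_smul_comm, Finset.mul_sum, mul_one]
    simp only [mul_comm κ (y i), mul_comm κ 2]
    module
  rw [hsum, PowerSeries.coeff_smul, map_sub, map_add, coeff_eulerDeriv, PowerSeries.coeff_smul,
    PowerSeries.coeff_smul, map_add]
  change y i • ((n : MvPolynomial (Fin 3) ℝ) * q κ n y + (1 + 12 * κ) • q κ n y -
    κ • (q κ n y + q κ n (-y))) = _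
  rw [q_neg, show (n : MvPolynomial (Fin 3) ℝ) * q κ n y = (n : ℝ) • q κ n y by
    simp [smul_eq_C_mul], show (-1) ^ n * q κ n y = ((-1 : ℝ) ^ n) • q κ n y by
    simp [smul_eq_C_mul]]
  module

end Icosahedral
end

noncomputable section
namespace Icosahedral

open MvPolynomial

/-! ### Values at the vertices -/

theorem tau_add_two_sq : (τ + 2) ^ 2 = 5 * τ ^ 2 := by
  have h := Real.goldenRatio_sq
  linear_combination -4 * h

theorem tau_pos : 0 < τ := Real.goldenRatio_pos

/-- The substitution `X ↦ X²`. -/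
abbrev expandTwo : PowerSeries ℝ →ₐ[ℝ] PowerSeries ℝ := PowerSeries.expand 2 two_ne_zero

theorem eulerDeriv_expandTwo (f : PowerSeries ℝ) :
    eulerDeriv ℝ (expandTwo f) = expandTwo ((2 : ℝ) • eulerDeriv ℝ f) := by
  ext n
  rw [coeff_eulerDeriv, PowerSeries.coeff_expand, PowerSeries.coeff_expand]
  split_ifs with h
  · obtain ⟨k, rfl⟩ := h
    rw [Nat.mul_div_cancel_left k two_pos, PowerSeries.coeff_smul, coeff_eulerDeriv]
    simp; ring
  · simp

theorem binomSeries_one_add_neg (a : ℝ) :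
    binomSeries 1 a + binomSeries 1 (-a) = expandTwo ((2 : ℝ) • binomSeries 1 (a ^ 2)) := by
  ext n
  rw [map_add, PowerSeries.coeff_expand, coeff_binomSeries, coeff_binomSeries]
  have h1 : ∀ m, poch 1 m / (m.factorial : ℝ) = 1 := fun m => by
    rw [poch_one, div_self (by positivity)]
  split_ifs with h
  · obtain ⟨k, rfl⟩ := h
    rw [Nat.mul_div_cancel_left k two_pos, PowerSeries.coeff_smul, coeff_binomSeries, h1, h1,
      pow_mul, pow_mul, neg_sq]
    simp; ring
  · rw [Odd.neg_pow (Nat.not_even_iff_odd.1 fun he => h he.two_dvd)]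
    ring

/-- The power series `(1 - 5τ²X)^{-s} (1 - τ²X)^{-t}`. -/
def vertexSeries (s t : ℝ) : PowerSeries ℝ :=
  binomSeries s (5 * τ ^ 2) * binomSeries t (τ ^ 2)

theorem coeff_vertexSeries (s t : ℝ) (n : ℕ) : PowerSeries.coeff n (vertexSeries s t) =
    τ ^ (2 * n) * ∑ j ∈ Finset.range (n + 1), poch s j * poch t (n - j) /
      ((j.factorial : ℝ) * ((n - j).factorial : ℝ)) * 5 ^ j := by
  rw [vertexSeries, PowerSeries.coeff_mul, Finset.Nat.sum_antidiagonal_eq_sum_range_succ_mk,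
    Finset.mul_sum]
  refine Finset.sum_congr rfl fun j hj => ?_
  have hj' : j ≤ n := by simpa [Nat.lt_succ_iff] using hj
  simp only [coeff_binomSeries, Algebra.algebraMap_self, RingHom.id_apply]
  have : τ ^ (2 * n) = (τ ^ 2) ^ j * (τ ^ 2) ^ (n - j) := by
    rw [← pow_add, ← pow_mul, Nat.add_sub_cancel' hj']
  rw [this, mul_pow, mul_div_mul_comm]
  ring

theorem eulerDeriv_vertexSeries (s t : ℝ) : eulerDeriv ℝ (vertexSeries s t) =
    s • vertexSeries (s + 1) t + t • vertexSeries s (t + 1) - (s + t) • vertexSeries s t := by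
  have h := derivation_mul_of_logDeriv (eulerDeriv ℝ) (eulerDeriv_binomSeries s (5 * τ ^ 2 : ℝ))
    (eulerDeriv_binomSeries t (τ ^ 2 : ℝ))
  rw [vertexSeries, h, vertexSeries, vertexSeries, binomSeries_succ, binomSeries_succ]
  simp only [smul_sub, mul_add, mul_sub, mul_smul_comm, mul_one, add_smul]
  simp only [mul_comm, mul_left_comm, mul_assoc]
  abel

/-- At order `n`, the Euler operator on `(1 - 5τ²X)^{-κ} (1 - τ²X)^{-5κ}` gives `κ Y0 + 5κ Y1` on
one side and `6κ + n` times the coefficient on the other, all scaled by `τ^{2n}`. -/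
theorem Y0_add_Y1 {κ : ℝ} (hκ : 0 < κ) (n : ℕ) : Y0 κ n + 5 * Y1 κ n = Y2 κ n := by
  have h := congrArg (PowerSeries.coeff n) (eulerDeriv_vertexSeries κ (5 * κ))
  rw [coeff_eulerDeriv, map_sub, map_add] at h
  simp only [PowerSeries.coeff_smul, coeff_vertexSeries, smul_eq_mul] at h
  have hτ : τ ^ (2 * n) ≠ 0 := pow_ne_zero _ tau_pos.ne'
  rw [Y2]
  refine mul_left_cancel₀ (mul_ne_zero hκ.ne' hτ) ?_
  rw [show κ * τ ^ (2 * n) * ((6 + (n : ℝ) / κ) * ∑ j ∈ Finset.range (n + 1),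
      poch κ j * poch (5 * κ) (n - j) / ((j.factorial : ℝ) * ((n - j).factorial : ℝ)) * 5 ^ j) =
      (6 * κ + n) * (τ ^ (2 * n) * ∑ j ∈ Finset.range (n + 1),
      poch κ j * poch (5 * κ) (n - j) / ((j.factorial : ℝ) * ((n - j).factorial : ℝ)) * 5 ^ j) by
    field_simp]
  rw [Y0, Y1]
  linear_combination -h

/-- Antipodal factors combine to `(1 - a²X²)^{-κ}`, with `a² = 5τ²` once and `a² = τ²` five times;
the comparison is made on logarithmic derivatives. -/
theorem map_invFun {κ : ℝ} {y : Fin 3 → ℝ} (hy : y ∈ vertices) :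
    PowerSeries.map (aeval y : MvPolynomial (Fin 3) ℝ →ₐ[ℝ] ℝ) (invFun κ) =
      expandTwo (vertexSeries κ (5 * κ)) := by
  have hprod : PowerSeries.map (aeval y : MvPolynomial (Fin 3) ℝ →ₐ[ℝ] ℝ) (invFun κ) =
      ∏ z ∈ vertices, binomSeries κ (y ⬝ᵥ z) := by
    rw [invFun, map_prod]
    refine Finset.prod_congr rfl fun z _ => ?_
    refine (map_binomSeries _ _ _).trans ?_
    rw [show aeval y (linForm z) = eval y (linForm z) by rw [← coe_aeval_eq_eval, RingHom.coe_coe],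
      eval_linForm]
  have hsum : ∑ z ∈ vertices, κ • (binomSeries 1 (y ⬝ᵥ z) - 1) =
      expandTwo ((2 : ℝ) • (κ • (binomSeries 1 (5 * τ ^ 2 : ℝ) - 1) +
        (5 * κ) • (binomSeries 1 (τ ^ 2 : ℝ) - 1))) := by
    rw [sum_dot_vertices hy fun t => κ • (binomSeries 1 t - 1)]
    have h1 := binomSeries_one_add_neg (τ + 2)
    have h2 := binomSeries_one_add_neg τ
    rw [tau_add_two_sq] at h1
    simp only [map_smul, map_add, map_sub, map_one] at h1 h2 ⊢
    rw [← eq_sub_iff_add_eq] at h1 h2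
    rw [h1, h2]
    module
  rw [hprod]
  refine eq_of_eulerDeriv_eq (g := ∑ z ∈ vertices, κ • (binomSeries 1 (y ⬝ᵥ z) - 1))
    (derivation_prod_of_logDeriv _ _ (fun z => binomSeries κ (y ⬝ᵥ z)) _
      fun z _ => eulerDeriv_binomSeries κ (y ⬝ᵥ z)) ?_ ?_ ?_
  · rw [hsum, eulerDeriv_expandTwo, ← map_mul, mul_smul_comm, vertexSeries,
      derivation_mul_of_logDeriv (eulerDeriv ℝ) (eulerDeriv_binomSeries κ (5 * τ ^ 2 : ℝ))
        (eulerDeriv_binomSeries (5 * κ) (τ ^ 2 : ℝ))]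
  · rw [map_sum]
    refine Finset.sum_eq_zero fun z _ => ?_
    rw [PowerSeries.coeff_smul, map_sub, coeff_zero_binomSeries]
    simp
  · rw [PowerSeries.coeff_expand, if_pos (dvd_zero 2), Nat.zero_div, coeff_vertexSeries]
    rw [PowerSeries.coeff_zero_eq_constantCoeff_apply, map_prod]
    simp only [← PowerSeries.coeff_zero_eq_constantCoeff_apply, coeff_zero_binomSeries]
    simp [poch_zero]

/-- In even degree, the sum over all twelve vertices is twice this one. The poles of `±y` raise `κ`
to `κ + 1` and yield `Y0`; the other ten raise `5κ` to `5κ + 1` and yield `5 Y1`. -/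
theorem sum_eval_q {κ : ℝ} (n : ℕ) {y : Fin 3 → ℝ} (hy : y ∈ vertices) :
    ∑ z ∈ posVertices, eval y (q κ (2 * n) z) = τ ^ (2 * n) * (Y0 κ n + 5 * Y1 κ n) := by
  have hq : ∀ z, eval y (q κ (2 * n) z) = PowerSeries.coeff (2 * n)
      (binomSeries 1 (y ⬝ᵥ z) * expandTwo (vertexSeries κ (5 * κ))) := fun z => by
    rw [← map_invFun hy, q, genFun_eq, ← coe_aeval_eq_eval, RingHom.coe_coe]
    have h := map_binomSeries (aeval y : MvPolynomial (Fin 3) ℝ →ₐ[ℝ] ℝ) 1 (linForm z)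
    rw [show aeval y (linForm z) = y ⬝ᵥ z by
      rw [← eval_linForm, ← coe_aeval_eq_eval, RingHom.coe_coe]] at h
    rw [← h, ← map_mul]
    exact (PowerSeries.coeff_map _ _ _).symm
  have hV : ∑ z ∈ vertices, eval y (q κ (2 * n) z) =
      2 * ∑ z ∈ posVertices, eval y (q κ (2 * n) z) := by
    rw [sum_vertices_eq_sum_posVertices, Finset.mul_sum]
    refine Finset.sum_congr rfl fun z _ => ?_
    rw [q_neg]
    simp [two_mul]
  refine mul_left_cancel₀ (two_ne_zero (α := ℝ)) (hV.symm.trans ?_)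
  simp only [hq]
  rw [← map_sum, ← Finset.sum_mul, sum_dot_vertices hy fun t => binomSeries 1 t,
    binomSeries_one_add_neg, tau_add_two_sq, ← smul_add, binomSeries_one_add_neg, ← map_nsmul,
    ← map_add, ← map_mul, PowerSeries.coeff_expand_mul]
  have h : ((2 : ℝ) • binomSeries 1 (5 * τ ^ 2) + 5 • (2 : ℝ) • binomSeries 1 (τ ^ 2)) *
      vertexSeries κ (5 * κ) =
      (2 : ℝ) • (vertexSeries (κ + 1) (5 * κ) + (5 : ℝ) • vertexSeries κ (5 * κ + 1)) := by
    simp only [vertexSeries, binomSeries_succ, add_mul, smul_mul_assoc, smul_add]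
    rw [mul_right_comm (binomSeries κ (5 * τ ^ 2)) (binomSeries 1 (5 * τ ^ 2)),
      mul_comm (binomSeries 1 (5 * τ ^ 2)), mul_comm (binomSeries 1 (τ ^ 2)), mul_assoc,
      mul_assoc]
    module
  rw [h]
  simp only [PowerSeries.coeff_smul, map_add, coeff_vertexSeries, smul_eq_mul, Y0, Y1]
  ring

/-! ### The normalized polynomials -/

/-- The polynomials `q_n / ν(n)`, which the Dunkl operators treat like `⟨x, y⟩^n / n!`. -/
def dunklPow (κ : ℝ) (n : ℕ) (y : Fin 3 → ℝ) : MvPolynomial (Fin 3) ℝ := (nu κ n)⁻¹ • q κ n y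

theorem dunklPow_zero (κ : ℝ) (y : Fin 3 → ℝ) : dunklPow κ 0 y = 1 := by
  rw [dunklPow, nu_zero, q_zero, inv_one, one_smul]

theorem isHomogeneous_smul {p : MvPolynomial (Fin 3) ℝ} {d : ℕ} (hp : p.IsHomogeneous d)
    (a : ℝ) : (a • p).IsHomogeneous d := by
  simpa [smul_eq_C_mul] using (isHomogeneous_C (Fin 3) a).mul hp

theorem dunklPow_isHomogeneous (κ : ℝ) (n : ℕ) (y : Fin 3 → ℝ) :
    (dunklPow κ n y).IsHomogeneous n := isHomogeneous_smul (q_isHomogeneous κ n y) _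

theorem dunkl_dunklPow_succ {κ : ℝ} (hκ : 0 < κ) (n : ℕ) (i : Fin 3) {y : Fin 3 → ℝ}
    (hy : y ∈ vertices) : dunkl κ i (dunklPow κ (n + 1) y) = y i • dunklPow κ n y := by
  rw [dunklPow, ← dunklLin_apply, map_smul, dunklLin_apply, dunkl_q_succ κ n i hy, smul_smul,
    dunklPow, smul_smul]
  congr 1
  have h1 := (nu_pos hκ (n + 1)).ne'
  have h2 := (nu_pos hκ n).ne'
  have h3 := nu_succ κ n
  field_simp
  rw [h3]
  ring

theorem dunkl_dunklPow_zero (κ : ℝ) (i : Fin 3) (y : Fin 3 → ℝ) :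
    dunkl κ i (dunklPow κ 0 y) = 0 := by
  rw [dunklPow_zero, ← C_1, dunkl_C]

theorem dunklLaplacian_dunklPow {κ : ℝ} (hκ : 0 < κ) (n : ℕ) {y : Fin 3 → ℝ}
    (hy : y ∈ vertices) :
    dunklLaplacian κ (dunklPow κ (n + 2) y) = (τ + 2) • dunklPow κ n y := by
  rw [dunklLaplacian, ← vertex_dot hy, dotProduct, Finset.sum_smul]
  refine Finset.sum_congr rfl fun i _ => ?_
  rw [dunkl_dunklPow_succ hκ _ _ hy, ← dunklLin_apply, map_smul, dunklLin_apply,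
    dunkl_dunklPow_succ hκ _ _ hy, smul_smul]

/-- The Dunkl Laplacian is linear. -/
def dunklLaplacianLin (κ : ℝ) : MvPolynomial (Fin 3) ℝ →ₗ[ℝ] MvPolynomial (Fin 3) ℝ :=
  ∑ i, dunklLin κ i ∘ₗ dunklLin κ i

theorem dunklLaplacianLin_apply (κ : ℝ) (p : MvPolynomial (Fin 3) ℝ) :
    dunklLaplacianLin κ p = dunklLaplacian κ p := by
  simp [dunklLaplacianLin, dunklLaplacian, dunklLin_apply]

/-- The invariant sums of the polynomials `q_n / ν(n)`. -/
def dunklPowG (κ : ℝ) (n : ℕ) : MvPolynomial (Fin 3) ℝ := ∑ y ∈ posVertices, dunklPow κ n y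

theorem dunklPowG_isHomogeneous (κ : ℝ) (n : ℕ) : (dunklPowG κ n).IsHomogeneous n :=
  IsHomogeneous.sum _ _ _ fun y _ => dunklPow_isHomogeneous κ n y

theorem dunklLaplacian_dunklPowG {κ : ℝ} (hκ : 0 < κ) (n : ℕ) :
    dunklLaplacian κ (dunklPowG κ (n + 2)) = (τ + 2) • dunklPowG κ n := by
  rw [← dunklLaplacianLin_apply, dunklPowG, map_sum, dunklPowG, Finset.smul_sum]
  exact Finset.sum_congr rfl fun y hy => by
    rw [dunklLaplacianLin_apply, dunklLaplacian_dunklPow hκ n (posVertices_subset hy)]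

theorem dunkl_dunklPowG_zero (κ : ℝ) (i : Fin 3) : dunkl κ i (dunklPowG κ 0) = 0 := by
  rw [← dunklLin_apply, dunklPowG, map_sum]
  exact Finset.sum_eq_zero fun y _ => dunkl_dunklPow_zero κ i y

theorem dunklLaplacian_dunklPowG_zero (κ : ℝ) : dunklLaplacian κ (dunklPowG κ 0) = 0 :=
  Finset.sum_eq_zero fun i _ => by
    rw [dunkl_dunklPowG_zero, ← dunklLin_apply, map_zero]

/-- The six chosen vertices are not permuted by reflections, but all twelve are, and evenness of the
degree identifies the full sum with twice the half sum. -/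
theorem reflPoly_dunklPowG (κ : ℝ) (n : ℕ) {v : Fin 3 → ℝ} (hv : v ∈ posRoots) :
    reflPoly v (dunklPowG κ (2 * n)) = dunklPowG κ (2 * n) := by
  have hV : ∑ y ∈ vertices, dunklPow κ (2 * n) y = (2 : ℝ) • dunklPowG κ (2 * n) := by
    rw [sum_vertices_eq_sum_posVertices, dunklPowG, Finset.smul_sum]
    refine Finset.sum_congr rfl fun z _ => ?_
    simp only [dunklPow]
    rw [q_neg, two_smul]
    simp
  have h : reflPoly v (∑ y ∈ vertices, dunklPow κ (2 * n) y) =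
      ∑ y ∈ vertices, dunklPow κ (2 * n) y := by
    simp only [map_sum, dunklPow, map_smul, reflPoly_q κ _ hv]
    refine Finset.sum_bij' (fun y _ => reflection v y) (fun y _ => reflection v y)
      (fun y hy => reflection_mem_vertices hv hy) (fun y hy => reflection_mem_vertices hv hy)
      ?_ ?_ fun _ _ => rfl
    all_goals
      intro y _
      exact (reflection v).left_inv y
  rw [hV, map_smul] at h
  exact (smul_right_injective _ (two_ne_zero (α := ℝ))) h

theorem isInvariant_of_reflPoly {p : MvPolynomial (Fin 3) ℝ}
    (h : ∀ v ∈ posRoots, reflPoly v p = p) : IsInvariant p := by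
  intro w hw
  induction hw using Subgroup.closure_induction with
  | mem w hw =>
    obtain ⟨v, hv, rfl⟩ := hw
    intro x
    rw [← eval_reflPoly, h v hv]
  | one => intro x; rfl
  | mul a b _ _ ha hb => intro x; exact (ha (b x)).trans (hb x)
  | inv a _ ha =>
    intro x
    have := ha (a⁻¹ x)
    rw [← this]
    congr 1
    exact (a.apply_symm_apply x).symm ▸ rfl

theorem sum_X_mul_dunkl_of_invariant (κ : ℝ) {p : MvPolynomial (Fin 3) ℝ} {d : ℕ}
    (hp : p.IsHomogeneous d) (h : ∀ v ∈ posRoots, reflPoly v p = p) :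
    ∑ i, X i * dunkl κ i p = (d : ℝ) • p := by
  rw [sum_X_mul_dunkl, hp.sum_X_mul_pderiv, Finset.sum_eq_zero fun v hv => by
    rw [h v hv, sub_self, mul_zero], add_zero, Nat.cast_smul_eq_nsmul]

/-! ### The harmonic invariant -/

/-- The coefficients of the harmonic projection. -/
def harmCoeff (κ : ℝ) (n j : ℕ) : ℝ :=
  (τ + 2) ^ j / (4 ^ j * (j.factorial : ℝ) * poch (-15 * κ - ((2 * n : ℕ) : ℝ) + 1 / 2) j)

/-- This recursion, matched to `dunklLaplacian_radiusSq_pow_mul`, is what determines the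
coefficients of a harmonic combination. -/
theorem harmCoeff_succ {κ : ℝ} (hκ : 0 < κ) {n j : ℕ} (hj : j < n) :
    harmCoeff κ n (j + 1) * (4 * (j + 1) * (j + (2 * (n - (j + 1)) : ℕ) + 3 / 2 + 15 * κ)) =
      -(harmCoeff κ n j * (τ + 2)) := by
  obtain ⟨k, rfl⟩ := Nat.exists_eq_add_of_lt hj
  rw [harmCoeff, harmCoeff, poch_succ, pow_succ, pow_succ, Nat.factorial_succ]
  set P := poch (-15 * κ - ((2 * (j + k + 1) : ℕ) : ℝ) + 1 / 2) j
  set B : ℝ := -15 * κ - ((2 * (j + k + 1) : ℕ) : ℝ) + 1 / 2 + j with hB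
  -- `B = -15κ - j - 2k - 3/2` is negative.
  have hB0 : B ≠ 0 := by
    rw [hB]; push_cast
    have : (0 : ℝ) ≤ j := Nat.cast_nonneg j
    have : (0 : ℝ) ≤ k := Nat.cast_nonneg k
    linarith [hκ]
  have hj0 : ((j : ℝ) + 1) ≠ 0 := by positivity
  have hBv : (j + (2 * (j + k + 1 - (j + 1)) : ℕ) + 3 / 2 + 15 * κ : ℝ) = -B := by
    rw [show j + k + 1 - (j + 1) = k by omega, hB]; push_cast; ring
  rw [hBv, show (4 : ℝ) ^ j * 4 * ((j + 1) * j.factorial : ℕ) * (P * B) =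
    (4 ^ j * j.factorial * P) * (4 * (j + 1) * B) by push_cast; ring, mul_div_mul_comm]
  have : (τ + 2) / (4 * (j + 1) * B) * (4 * (j + 1) * -B) = -(τ + 2) := by
    field_simp
  rw [mul_assoc, this]
  ring

theorem phiG_eq (κ : ℝ) (n : ℕ) : phiG κ n = nu κ (2 * n) •
    ∑ j ∈ Finset.range (n + 1), harmCoeff κ n j •
      (radiusSq ^ j * dunklPowG κ (2 * (n - j))) := by
  rw [phiG, Finset.smul_sum]
  simp only [phi, Nat.mul_div_cancel_left n two_pos]
  rw [Finset.sum_comm]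
  refine Finset.sum_congr rfl fun j hj => ?_
  rw [dunklPowG, Finset.mul_sum, Finset.smul_sum, Finset.smul_sum]
  refine Finset.sum_congr rfl fun y _ => ?_
  rw [Nat.mul_sub, dunklPow, mul_assoc, ← smul_eq_C_mul, mul_smul_comm, smul_smul, smul_smul]
  congr 1
  rw [harmCoeff]
  ring

theorem phiG_isHomogeneous (κ : ℝ) (n : ℕ) : (phiG κ n).IsHomogeneous (2 * n) := by
  rw [phiG_eq κ]
  refine isHomogeneous_smul (IsHomogeneous.sum _ _ _ fun j hj => isHomogeneous_smul ?_ _) _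
  have h := (radiusSq_isHomogeneous.pow j).mul (dunklPowG_isHomogeneous κ (2 * (n - j)))
  have hj' : j ≤ n := by simpa [Nat.lt_succ_iff] using hj
  rwa [show 2 * j + 2 * (n - j) = 2 * n by omega] at h

theorem reflPoly_phiG (κ : ℝ) (n : ℕ) {v : Fin 3 → ℝ} (hv : v ∈ posRoots) :
    reflPoly v (phiG κ n) = phiG κ n := by
  rw [phiG_eq κ]
  simp only [map_smul, map_sum, map_mul, map_pow, reflPoly_dunklPowG κ _ hv,
    reflPoly_radiusSq v hv]

/-- Each summand contributes `A j`, from `Δ_κ` on the invariant factor, and for positive index also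
a term `-g (j - 1)`, from the power of `|x|²`. Since `A j = g j` below `n` and `A n = 0`, everything
cancels. -/
theorem dunklLaplacian_phiG {κ : ℝ} (hκ : 0 < κ) (n : ℕ) : dunklLaplacian κ (phiG κ n) = 0 := by
  rw [phiG_eq κ, ← dunklLaplacianLin_apply, map_smul, map_sum]
  simp only [map_smul, dunklLaplacianLin_apply]
  set g : ℕ → MvPolynomial (Fin 3) ℝ := fun j =>
    (harmCoeff κ n j * (τ + 2)) • (radiusSq ^ j * dunklPowG κ (2 * (n - (j + 1))))
  set A : ℕ → MvPolynomial (Fin 3) ℝ := fun j =>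
    harmCoeff κ n j • (radiusSq ^ j * dunklLaplacian κ (dunklPowG κ (2 * (n - j))))
  have hA : ∀ j < n, A j = g j := fun j hj => by
    simp only [A, g]
    rw [show 2 * (n - j) = 2 * (n - (j + 1)) + 2 by omega, dunklLaplacian_dunklPowG hκ,
      mul_smul_comm, smul_smul]
  have hAn : A n = 0 := by
    simp only [A]
    rw [Nat.sub_self, mul_zero, dunklLaplacian_dunklPowG_zero, mul_zero, smul_zero]
  have h0 : harmCoeff κ n 0 • dunklLaplacian κ (radiusSq ^ 0 * dunklPowG κ (2 * (n - 0))) = A 0 := by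
    simp only [A, pow_zero, one_mul]
  have hs : ∀ j ∈ Finset.range n, harmCoeff κ n (j + 1) • dunklLaplacian κ
      (radiusSq ^ (j + 1) * dunklPowG κ (2 * (n - (j + 1)))) = A (j + 1) - g j := fun j hj => by
    rw [dunklLaplacian_radiusSq_pow_mul κ (dunklPowG_isHomogeneous κ _), ← smul_eq_C_mul,
      smul_add, smul_smul, harmCoeff_succ hκ (Finset.mem_range.1 hj), neg_smul, ← sub_eq_add_neg]
  rw [Finset.sum_range_succ', h0, Finset.sum_congr rfl hs, Finset.sum_sub_distrib, sub_add_eq_add_sub,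
    ← Finset.sum_range_succ' A n, Finset.sum_range_succ, hAn, add_zero,
    Finset.sum_congr rfl fun j hj => hA j (Finset.mem_range.1 hj), sub_self, smul_zero]

end Icosahedral
end

noncomputable section
namespace Icosahedral

open MvPolynomial MeasureTheory Filter Topology

/-! ### Integrability -/

theorem continuous_eval (p : MvPolynomial (Fin 3) ℝ) : Continuous fun x => eval x p :=
  MvPolynomial.continuous_eval p

theorem integrable_eval_mul_exp {ω : ℝ} (hω : 0 < ω) (p : MvPolynomial (Fin 3) ℝ) :
    Integrable fun x : Fin 3 → ℝ => eval x p * Real.exp (-ω * (x ⬝ᵥ x)) := by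
  induction p using MvPolynomial.induction_on' with
  | monomial s a =>
    have h : ∀ i : Fin 3, Integrable fun t : ℝ => t ^ (s i) * Real.exp (-ω * t ^ 2) := fun i => by
      have := integrable_rpow_mul_exp_neg_mul_sq hω (s := (s i : ℝ))
        (by have : (0 : ℝ) ≤ s i := Nat.cast_nonneg _
            linarith)
      simpa using this
    refine ((Integrable.fintype_prod h).const_mul a).congr (ae_of_all _ fun x => ?_)
    simp only [eval_monomial, Finset.prod_mul_distrib, ← Real.exp_sum]
    rw [Finsupp.prod_fintype _ _ (by simp), dotProduct, Finset.mul_sum, mul_assoc]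
    simp only [sq]
  | add p q hp hq =>
    simp only [map_add, add_mul]
    exact hp.add hq

/-- The density with `|t|^{2κ}` replaced by `(t² + ε)^κ`. -/
def regDensity (κ ω ε : ℝ) (x : Fin 3 → ℝ) : ℝ :=
  Real.exp (-ω * (x ⬝ᵥ x)) * ∏ v ∈ posRoots, ((x ⬝ᵥ v) ^ 2 + ε) ^ κ

theorem regDensity_zero (κ ω : ℝ) (x : Fin 3 → ℝ) : regDensity κ ω 0 x = density κ ω x := by
  rw [regDensity, density, weight, ← Finset.prod_pow]
  congr 1
  refine Finset.prod_congr rfl fun v _ => ?_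
  rw [add_zero, ← sq_abs, ← Real.rpow_natCast, ← Real.rpow_natCast, ← Real.rpow_mul (abs_nonneg _),
    ← Real.rpow_mul (abs_nonneg _), mul_comm]

theorem regDensity_nonneg (κ ω : ℝ) {ε : ℝ} (hε : 0 ≤ ε) (x : Fin 3 → ℝ) :
    0 ≤ regDensity κ ω ε x := by
  unfold regDensity; positivity

theorem continuous_regDensity {κ : ℝ} (hκ : 0 < κ) (ω ε : ℝ) : Continuous (regDensity κ ω ε) := by
  unfold regDensity
  refine Continuous.mul (by fun_prop) (continuous_finsetProd _ fun v _ => ?_)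
  exact Continuous.rpow_const (by fun_prop) fun x => Or.inr hκ.le

/-- A polynomial majorant of the regularized weights. -/
def weightBound (κ : ℝ) : MvPolynomial (Fin 3) ℝ :=
  ∏ v ∈ posRoots, (linForm v ^ 2 + 1) ^ ⌈κ⌉₊

/-- The bound is uniform in `ε ≤ 1`, hence usable for dominated convergence. After `ε` is replaced
by 1 the base is at least 1, so `κ` may be rounded up to make the majorant polynomial. -/
theorem regDensity_le {κ : ℝ} (hκ : 0 < κ) (ω : ℝ) {ε : ℝ} (hε : 0 ≤ ε) (hε1 : ε ≤ 1)
    (x : Fin 3 → ℝ) :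
    regDensity κ ω ε x ≤ eval x (weightBound κ) * Real.exp (-ω * (x ⬝ᵥ x)) := by
  rw [regDensity, mul_comm, weightBound, map_prod]
  gcongr with v hv
  simp only [map_pow, map_add, eval_linForm, map_one]
  rw [← Real.rpow_natCast _ ⌈κ⌉₊]
  calc ((x ⬝ᵥ v) ^ 2 + ε) ^ κ ≤ ((x ⬝ᵥ v) ^ 2 + 1) ^ κ := by gcongr
    _ ≤ _ := Real.rpow_le_rpow_of_exponent_le (by nlinarith [sq_nonneg (x ⬝ᵥ v)]) (Nat.le_ceil κ)

theorem integrable_bound {ω : ℝ} (hω : 0 < ω) (κ : ℝ) (p : MvPolynomial (Fin 3) ℝ) :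
    Integrable fun x : Fin 3 → ℝ =>
      |eval x p| * (eval x (weightBound κ) * Real.exp (-ω * (x ⬝ᵥ x))) := by
  refine (integrable_eval_mul_exp hω (p * weightBound κ)).norm.congr (ae_of_all _ fun x => ?_)
  have h : 0 ≤ eval x (weightBound κ) := by
    rw [weightBound, map_prod]
    refine Finset.prod_nonneg fun v _ => ?_
    simp only [map_pow, map_add, eval_linForm, map_one]
    positivity
  simp only [Real.norm_eq_abs, map_mul, abs_mul, abs_of_nonneg h, Real.abs_exp]
  ring

theorem integrable_mul_regDensity {κ ω ε : ℝ} (hκ : 0 < κ) (hω : 0 < ω) (hε : 0 ≤ ε)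
    (hε1 : ε ≤ 1) (p : MvPolynomial (Fin 3) ℝ) {f : (Fin 3 → ℝ) → ℝ}
    (hf : AEStronglyMeasurable f) (hfp : ∀ x, |f x| ≤ |eval x p|) :
    Integrable fun x => f x * regDensity κ ω ε x := by
  refine (integrable_bound hω κ p).mono'
    (hf.mul (continuous_regDensity hκ ω ε).aestronglyMeasurable) (ae_of_all _ fun x => ?_)
  rw [Real.norm_eq_abs, abs_mul, abs_of_nonneg (regDensity_nonneg κ ω hε x)]
  exact mul_le_mul (hfp x) (regDensity_le hκ ω hε hε1 x) (regDensity_nonneg κ ω hε x)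
    (abs_nonneg _)

theorem integrable_eval_regDensity {κ ω ε : ℝ} (hκ : 0 < κ) (hω : 0 < ω) (hε : 0 ≤ ε)
    (hε1 : ε ≤ 1) (p : MvPolynomial (Fin 3) ℝ) :
    Integrable fun x => eval x p * regDensity κ ω ε x :=
  integrable_mul_regDensity hκ hω hε hε1 p (continuous_eval p).aestronglyMeasurable
    fun _ => le_rfl

theorem integrable_eval_density {κ ω : ℝ} (hκ : 0 < κ) (hω : 0 < ω)
    (p : MvPolynomial (Fin 3) ℝ) : Integrable fun x => eval x p * density κ ω x := by
  simpa only [regDensity_zero] using integrable_eval_regDensity hκ hω le_rfl zero_le_one p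

theorem integrable_density {κ ω : ℝ} (hκ : 0 < κ) (hω : 0 < ω) : Integrable (density κ ω) := by
  simpa using integrable_eval_density hκ hω 1

/-- The support is open, and it contains any point where the product of the root forms, a nonzero
polynomial, does not vanish. -/
theorem integral_density_pos {κ ω : ℝ} (hκ : 0 < κ) (hω : 0 < ω) :
    0 < ∫ x : Fin 3 → ℝ, density κ ω x := by
  have hc : Continuous (density κ ω) := by
    simpa only [← funext (regDensity_zero κ ω)] using continuous_regDensity hκ ω 0
  have h0 : 0 ≤ density κ ω := fun x => by
    rw [← regDensity_zero]; exact regDensity_nonneg κ ω le_rfl x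
  rw [integral_pos_iff_support_of_nonneg h0 (integrable_density hκ hω)]
  refine hc.isOpen_support.measure_pos _ ?_
  have hne : (∏ v ∈ posRoots, linForm v) ≠ 0 :=
    Finset.prod_ne_zero_iff.2 fun v hv => linForm_ne_zero hv
  obtain ⟨x, hx⟩ : ∃ x, eval x (∏ v ∈ posRoots, linForm v) ≠ 0 := by
    by_contra! h
    exact hne (MvPolynomial.funext fun x => by rw [h x, map_zero])
  refine ⟨x, ?_⟩
  rw [map_prod, Finset.prod_ne_zero_iff] at hx
  rw [Function.mem_support, density, weight]
  refine mul_ne_zero (Real.exp_pos _).ne' (pow_ne_zero _ (Finset.prod_ne_zero_iff.2 fun v hv => ?_))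
  have := hx v hv
  rw [eval_linForm] at this
  exact (Real.rpow_pos_of_pos (abs_pos.2 this) κ).ne'

/-! ### Invariance under the reflections -/

theorem reflection_dot {v : Fin 3 → ℝ} (hv : v ∈ posRoots) (x y : Fin 3 → ℝ) :
    reflection v x ⬝ᵥ y = x ⬝ᵥ reflection v y := by
  rw [reflection_root hv, reflection_root hv]
  simp only [sub_dotProduct, smul_dotProduct, dotProduct_sub, dotProduct_smul, smul_eq_mul,
    dotProduct_comm v y]
  ring

theorem reflection_reflection (v x : Fin 3 → ℝ) : reflection v (reflection v x) = x :=
  (reflection v).left_inv x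

theorem regDensity_reflection (κ ω ε : ℝ) {v : Fin 3 → ℝ} (hv : v ∈ posRoots) (x : Fin 3 → ℝ) :
    regDensity κ ω ε (reflection v x) = regDensity κ ω ε x := by
  rw [regDensity, regDensity, reflection_dot hv, reflection_reflection]
  simp only [reflection_dot hv]
  rw [prod_roots_reflection hv (fun u => ((x ⬝ᵥ u) ^ 2 + ε) ^ κ) fun u => by
    rw [dotProduct_neg, neg_sq]]

/-- An involution has determinant `±1` and preserves Lebesgue measure. -/
theorem integral_comp_reflection (v : Fin 3 → ℝ) (f : (Fin 3 → ℝ) → ℝ) :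
    ∫ x, f (reflection v x) = ∫ x, f x := by
  set T : (Fin 3 → ℝ) →ₗ[ℝ] (Fin 3 → ℝ) := (reflection v : (Fin 3 → ℝ) →ₗ[ℝ] (Fin 3 → ℝ)) with hT
  have hTT : T * T = 1 := LinearMap.ext fun x => reflection_reflection v x
  have hdet : LinearMap.det T * LinearMap.det T = 1 := by rw [← map_mul, hTT, map_one]
  have hdet0 : LinearMap.det T ≠ 0 := left_ne_zero_of_mul_eq_one hdet
  have habs : |(LinearMap.det T)⁻¹| = 1 := by
    rw [inv_eq_of_mul_eq_one_left hdet]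
    rcases mul_self_eq_one_iff.1 hdet with h | h <;> simp [h]
  have hmap := Real.map_linearMap_volume_pi_eq_smul_volume_pi hdet0
  rw [habs, ENNReal.ofReal_one, one_smul] at hmap
  have hemb : MeasurableEmbedding (reflection v) :=
    (reflection v).toContinuousLinearEquiv.toHomeomorph.measurableEmbedding
  have := hemb.integral_map (μ := volume) f
  rw [← this]
  congr 1

/-! ### Integration by parts -/

theorem hasLineDerivAt_eval (i : Fin 3) (p : MvPolynomial (Fin 3) ℝ) (x : Fin 3 → ℝ) :
    HasLineDerivAt ℝ (fun x => eval x p) (eval x (pderiv i p)) x (Pi.single i 1) := by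
  unfold HasLineDerivAt
  induction p using MvPolynomial.induction_on with
  | C a => simpa using hasDerivAt_const (0 : ℝ) a
  | add p q hp hq =>
    simp only [map_add]
    exact hp.add hq
  | mul_X p k hp =>
    have hk : HasDerivAt (fun t : ℝ => x k + t * Pi.single (M := fun _ => ℝ) i 1 k)
        (Pi.single (M := fun _ => ℝ) i 1 k) 0 := by
      simpa using ((hasDerivAt_id (0 : ℝ)).mul_const
        (Pi.single (M := fun _ => ℝ) i 1 k)).const_add (x k)
    have h := hp.mul hk
    simp only [map_mul, eval_X, Derivation.leibniz, pderiv_X, smul_eq_mul, map_add, Pi.add_apply,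
      Pi.smul_apply]
    convert! h using 1
    simp [Pi.single_apply, apply_ite]
    rcases eq_or_ne k i with rfl | hki
    · simp; ring
    · simp [hki]; ring

theorem hasDerivAt_prod_of_logDeriv {ι : Type*} (s : Finset ι) (f : ι → ℝ → ℝ) (g : ι → ℝ) (a : ℝ)
    (h : ∀ i ∈ s, HasDerivAt (f i) (f i a * g i) a) :
    HasDerivAt (fun t => ∏ i ∈ s, f i t) ((∏ i ∈ s, f i a) * ∑ i ∈ s, g i) a := by
  classical
  induction s using Finset.induction_on with
  | empty => simpa using hasDerivAt_const a (1 : ℝ)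
  | insert b s hb ih =>
    have h1 := (h b (Finset.mem_insert_self b s)).mul
      (ih fun i hi => h i (Finset.mem_insert_of_mem hi))
    simp only [Finset.prod_insert hb, Finset.sum_insert hb]
    convert! h1 using 1
    ring

theorem hasLineDerivAt_regDensity (κ ω : ℝ) {ε : ℝ} (hε : 0 < ε) (i : Fin 3) (x : Fin 3 → ℝ) :
    HasLineDerivAt ℝ (regDensity κ ω ε) (regDensity κ ω ε x * (-(2 * ω * x i) +
      ∑ v ∈ posRoots, 2 * κ * v i * ((x ⬝ᵥ v) / ((x ⬝ᵥ v) ^ 2 + ε)))) x (Pi.single i 1) := by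
  unfold HasLineDerivAt
  have hx : ∀ v : Fin 3 → ℝ, HasDerivAt (fun t : ℝ => (x + t • Pi.single i 1) ⬝ᵥ v) (v i) 0 := by
    intro v
    simpa [add_dotProduct] using
      ((hasDerivAt_id (0 : ℝ)).mul_const (v i)).const_add (x ⬝ᵥ v)
  have hxx : HasDerivAt (fun t : ℝ => (x + t • Pi.single (M := fun _ => ℝ) i 1) ⬝ᵥ
      (x + t • Pi.single (M := fun _ => ℝ) i 1)) (2 * x i) 0 := by
    have h1 : HasDerivAt (fun t : ℝ => x ⬝ᵥ x + t * (2 * x i) + t ^ 2) (2 * x i) 0 := by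
      have := (((hasDerivAt_id (0 : ℝ)).mul_const (2 * x i)).const_add (x ⬝ᵥ x)).add
        (hasDerivAt_pow 2 (0 : ℝ))
      simp only [one_mul, Nat.cast_ofNat, Nat.add_one_sub_one, pow_one, mul_zero, add_zero] at this
      exact this
    convert! h1 using 1
    ext t
    simp [add_dotProduct, dotProduct_add]
    ring
  have hexp := (hxx.const_mul (-ω)).exp
  have hprod := hasDerivAt_prod_of_logDeriv posRoots
    (fun v (t : ℝ) => (((x + t • Pi.single (M := fun _ => ℝ) i 1) ⬝ᵥ v) ^ 2 + ε) ^ κ)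
    (fun v => 2 * κ * v i * ((x ⬝ᵥ v) / ((x ⬝ᵥ v) ^ 2 + ε))) 0 fun v _ => by
      have hpos : 0 < (x ⬝ᵥ v) ^ 2 + ε := by positivity
      have h1 := (((hx v).pow 2).add_const ε).rpow_const (p := κ) (Or.inl (by
        simp only [zero_smul, add_zero, Pi.pow_apply]; exact hpos.ne'))
      convert! h1 using 1
      simp only [zero_smul, add_zero, Pi.pow_apply]
      rw [Real.rpow_sub_one hpos.ne']
      field_simp
      simp; ring
  have h := hexp.mul hprod
  convert! h using 1
  simp only [zero_smul, add_zero, regDensity]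
  ring

theorem abs_div_sq_add_le {ε : ℝ} (hε : 0 < ε) (t : ℝ) : |t / (t ^ 2 + ε)| ≤ |t| * ε⁻¹ := by
  rw [abs_div, abs_of_pos (by positivity : 0 < t ^ 2 + ε), div_eq_mul_inv]
  gcongr
  nlinarith [sq_nonneg t]

/-- For small `κ` the density itself is not differentiable on the mirrors; with `ε > 0` its
logarithmic derivative is finite everywhere. -/
theorem integral_regDensity_by_parts {κ ω ε : ℝ} (hκ : 0 < κ) (hω : 0 < ω) (hε : 0 < ε)
    (hε1 : ε ≤ 1) (i : Fin 3) (p : MvPolynomial (Fin 3) ℝ) :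
    2 * ω * ∫ x, eval x (X i * p) * regDensity κ ω ε x =
      (∫ x, eval x (pderiv i p) * regDensity κ ω ε x) +
      ∑ v ∈ posRoots, κ * v i * ∫ x, eval x (dividedDiff v p) *
        ((x ⬝ᵥ v) ^ 2 / ((x ⬝ᵥ v) ^ 2 + ε)) * regDensity κ ω ε x := by
  have hpos : ∀ (x v : Fin 3 → ℝ), 0 < (x ⬝ᵥ v) ^ 2 + ε := fun x v => by positivity
  have hcont : ∀ (r : MvPolynomial (Fin 3) ℝ) (v : Fin 3 → ℝ),
      Continuous fun x : Fin 3 → ℝ => eval x r * ((x ⬝ᵥ v) / ((x ⬝ᵥ v) ^ 2 + ε)) := fun r v =>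
    (continuous_eval r).mul (Continuous.div (by fun_prop) (by fun_prop) fun x => (hpos x v).ne')
  -- The majorant grows like `1/ε`, which is harmless at fixed `ε`; the limit is taken only after
  -- symmetrization has removed the singularity.
  have hint : ∀ (r : MvPolynomial (Fin 3) ℝ) (v : Fin 3 → ℝ),
      Integrable fun x : Fin 3 → ℝ => eval x r * ((x ⬝ᵥ v) / ((x ⬝ᵥ v) ^ 2 + ε)) *
        regDensity κ ω ε x := fun r v =>
    integrable_mul_regDensity hκ hω hε.le hε1 (r * (linForm v * C ε⁻¹))
      (hcont r v).aestronglyMeasurable fun x => by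
        simp only [map_mul, eval_linForm, eval_C, abs_mul]
        rw [abs_of_pos (inv_pos.2 hε)]
        gcongr
        exact abs_div_sq_add_le hε _
  have hpoly := integrable_eval_regDensity hκ hω hε.le hε1
  -- the integrand produced by differentiating the density
  have hsplit : ∀ x, eval x p * (regDensity κ ω ε x * (-(2 * ω * x i) +
      ∑ v ∈ posRoots, 2 * κ * v i * ((x ⬝ᵥ v) / ((x ⬝ᵥ v) ^ 2 + ε)))) =
      -(2 * ω) * (eval x (X i * p) * regDensity κ ω ε x) + ∑ v ∈ posRoots, 2 * κ * v i *
        (eval x p * ((x ⬝ᵥ v) / ((x ⬝ᵥ v) ^ 2 + ε)) * regDensity κ ω ε x) := fun x => by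
    rw [map_mul, eval_X, mul_add, mul_add, Finset.mul_sum, Finset.mul_sum]
    congr 1
    · ring
    · exact Finset.sum_congr rfl fun v _ => by ring
  have hsum : Integrable fun x => ∑ v ∈ posRoots, 2 * κ * v i *
        (eval x p * ((x ⬝ᵥ v) / ((x ⬝ᵥ v) ^ 2 + ε)) * regDensity κ ω ε x) :=
    integrable_finsetSum _ fun v _ => (hint p v).const_mul _
  have hparts := integral_bilinear_hasLineDerivAt_right_eq_neg_left_of_integrable
    (μ := (volume : Measure (Fin 3 → ℝ))) (B := ContinuousLinearMap.mul ℝ ℝ)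
    (f := fun x => eval x p) (f' := fun x => eval x (pderiv i p))
    (g := regDensity κ ω ε) (v := Pi.single i 1) (hpoly _)
    (by
      simp only [ContinuousLinearMap.mul_apply', hsplit]
      exact ((hpoly _).const_mul _).add hsum)
    (hpoly p) (fun x _ => hasLineDerivAt_eval i p x)
    (fun x _ => hasLineDerivAt_regDensity κ ω hε i x)
  simp only [ContinuousLinearMap.mul_apply', hsplit] at hparts
  rw [integral_add ((hpoly _).const_mul _) hsum, integral_const_mul,
    integral_finsetSum _ fun v _ => (hint p v).const_mul _] at hparts
  -- The factor `t / (t² + ε)`, `t = ⟨x, v⟩`, is odd under `σ_v`, so `p` may be replaced by half of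
  -- `p - p ∘ σ_v = t · dividedDiff v p`. This turns `2κ` into `κ` and leaves the bounded factor `t²
  -- / (t² + ε)`.
  have hsymm : ∀ v ∈ posRoots, ∫ x, 2 * κ * v i *
        (eval x p * ((x ⬝ᵥ v) / ((x ⬝ᵥ v) ^ 2 + ε)) * regDensity κ ω ε x) =
      κ * v i * ∫ x, eval x (dividedDiff v p) *
        ((x ⬝ᵥ v) ^ 2 / ((x ⬝ᵥ v) ^ 2 + ε)) * regDensity κ ω ε x := fun v hv => by
    have h1 : ∫ x, eval x p * ((x ⬝ᵥ v) / ((x ⬝ᵥ v) ^ 2 + ε)) * regDensity κ ω ε x =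
        -∫ x, eval x (reflPoly v p) * ((x ⬝ᵥ v) / ((x ⬝ᵥ v) ^ 2 + ε)) * regDensity κ ω ε x := by
      rw [← integral_comp_reflection v, ← integral_neg]
      refine integral_congr_ae (ae_of_all _ fun x => ?_)
      have : reflection v x ⬝ᵥ v = -(x ⬝ᵥ v) := by
        rw [reflection_root hv, sub_dotProduct, smul_dotProduct, root_dot hv, smul_eq_mul]
        ring
      simp only [this, regDensity_reflection κ ω ε hv, ← eval_reflPoly, neg_sq]
      ring
    have h2 : ∫ x, eval x (dividedDiff v p) *
        ((x ⬝ᵥ v) ^ 2 / ((x ⬝ᵥ v) ^ 2 + ε)) * regDensity κ ω ε x =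
        (∫ x, eval x p * ((x ⬝ᵥ v) / ((x ⬝ᵥ v) ^ 2 + ε)) * regDensity κ ω ε x) -
        ∫ x, eval x (reflPoly v p) * ((x ⬝ᵥ v) / ((x ⬝ᵥ v) ^ 2 + ε)) * regDensity κ ω ε x := by
      rw [← integral_sub (hint p v) (hint _ v)]
      refine integral_congr_ae (ae_of_all _ fun x => ?_)
      have := congrArg (eval x) (linForm_mul_dividedDiff v p)
      simp only [map_mul, map_sub, eval_linForm] at this
      simp only [← sub_mul, ← this]
      ring
    rw [integral_const_mul, h2]
    linear_combination κ * v i * h1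
  rw [Finset.sum_congr rfl hsymm] at hparts
  linarith

/-- The integral against the density. -/
def densityIntegral (κ ω : ℝ) (p : MvPolynomial (Fin 3) ℝ) : ℝ :=
  ∫ x, eval x p * density κ ω x

/-- Convergence of `F` is needed only off the zeros of the limiting density: at a zero the
regularized density tends to 0 and `F` is bounded by 1. -/
theorem tendsto_integral_regDensity {κ ω : ℝ} (hκ : 0 < κ) (hω : 0 < ω)
    (p : MvPolynomial (Fin 3) ℝ) {F : ℕ → (Fin 3 → ℝ) → ℝ} (hF : ∀ n, Continuous (F n))
    (hF1 : ∀ n x, |F n x| ≤ 1)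
    (hlim : ∀ x, regDensity κ ω 0 x ≠ 0 → Tendsto (fun n => F n x) atTop (𝓝 1)) :
    Tendsto (fun n : ℕ => ∫ x, eval x p * F n x * regDensity κ ω (1 / ((n : ℝ) + 1)) x) atTop
      (𝓝 (densityIntegral κ ω p)) := by
  have hε : ∀ n : ℕ, (0 : ℝ) ≤ 1 / ((n : ℝ) + 1) ∧ 1 / ((n : ℝ) + 1) ≤ 1 := fun n =>
    ⟨by positivity, by
      rw [div_le_one (by positivity)]
      linarith [Nat.cast_nonneg (α := ℝ) n]⟩
  refine tendsto_integral_of_dominated_convergence _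
    (fun n => (((continuous_eval p).mul (hF n)).mul
      (continuous_regDensity hκ ω _)).aestronglyMeasurable) (integrable_bound hω κ p)
    (fun n => ae_of_all _ fun x => ?_) (ae_of_all _ fun x => ?_)
  · rw [Real.norm_eq_abs, abs_mul, abs_mul,
      abs_of_nonneg (regDensity_nonneg κ ω (hε n).1 x)]
    refine mul_le_mul ?_ (regDensity_le hκ ω (hε n).1 (hε n).2 x)
      (regDensity_nonneg κ ω (hε n).1 x) (abs_nonneg _)
    exact mul_le_of_le_one_right (abs_nonneg _) (hF1 n x)
  · have hreg : Tendsto (fun n : ℕ => regDensity κ ω (1 / ((n : ℝ) + 1)) x) atTop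
        (𝓝 (regDensity κ ω 0 x)) := by
      unfold regDensity
      refine Tendsto.const_mul _ (tendsto_finsetProd _ fun v _ => ?_)
      exact (tendsto_one_div_add_atTop_nhds_zero_nat.const_add _).rpow_const (Or.inr hκ.le)
    rw [← regDensity_zero]
    by_cases h0 : regDensity κ ω 0 x = 0
    · rw [h0, mul_zero]
      rw [h0] at hreg
      refine squeeze_zero_norm (fun n => ?_) (show Tendsto (fun n : ℕ => |eval x p| *
        ‖regDensity κ ω (1 / ((n : ℝ) + 1)) x‖) atTop (𝓝 0) by
          simpa using hreg.norm.const_mul |eval x p|)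
      rw [norm_mul, norm_mul]
      gcongr
      exact mul_le_of_le_one_right (abs_nonneg _) (hF1 n x)
    · simpa using ((hlim x h0).const_mul (eval x p)).mul hreg

/-- Integration by parts for the Dunkl operators. -/
theorem densityIntegral_dunkl {κ ω : ℝ} (hκ : 0 < κ) (hω : 0 < ω) (i : Fin 3)
    (p : MvPolynomial (Fin 3) ℝ) :
    2 * ω * densityIntegral κ ω (X i * p) = densityIntegral κ ω (pderiv i p) +
      ∑ v ∈ posRoots, κ * v i * densityIntegral κ ω (dividedDiff v p) := by
  have hconst : ∀ r, Tendsto (fun n : ℕ => ∫ x, eval x r * regDensity κ ω (1 / ((n : ℝ) + 1)) x)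
      atTop (𝓝 (densityIntegral κ ω r)) := fun r => by
    simpa using tendsto_integral_regDensity hκ hω r (F := fun _ _ => 1)
      (fun _ => continuous_const) (fun _ _ => by simp) fun _ _ => tendsto_const_nhds
  have hroot : ∀ v ∈ posRoots, Tendsto (fun n : ℕ => ∫ x, eval x (dividedDiff v p) *
      ((x ⬝ᵥ v) ^ 2 / ((x ⬝ᵥ v) ^ 2 + 1 / ((n : ℝ) + 1))) *
      regDensity κ ω (1 / ((n : ℝ) + 1)) x) atTop
      (𝓝 (densityIntegral κ ω (dividedDiff v p))) := fun v hv => by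
    refine tendsto_integral_regDensity hκ hω (dividedDiff v p)
      (F := fun n x => (x ⬝ᵥ v) ^ 2 / ((x ⬝ᵥ v) ^ 2 + 1 / ((n : ℝ) + 1))) (fun n => ?_)
      (fun n x => ?_) fun x hx => ?_
    · exact Continuous.div (by fun_prop) (by fun_prop) fun x => by positivity
    · rw [abs_of_nonneg (by positivity)]
      exact div_le_one_of_le₀ (le_add_of_nonneg_right (by positivity)) (by positivity)
    -- As `κ > 0`, the density vanishes on the mirror of `v`, so such points are excluded.
    · have hxv : (x ⬝ᵥ v) ^ 2 ≠ 0 := fun h => hx (by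
        rw [regDensity, Finset.prod_eq_zero hv, mul_zero]
        rw [h, add_zero, Real.zero_rpow hκ.ne'])
      have := (tendsto_const_nhds (x := (x ⬝ᵥ v) ^ 2)).div
        ((tendsto_one_div_add_atTop_nhds_zero_nat (𝕜 := ℝ)).const_add ((x ⬝ᵥ v) ^ 2)) (by simpa using hxv)
      rw [add_zero, div_self hxv] at this
      exact this
  have hL := (hconst (X i * p)).const_mul (2 * ω)
  have hR := (hconst (pderiv i p)).add (tendsto_finsetSum posRoots fun v hv =>
    (hroot v hv).const_mul (κ * v i))
  refine tendsto_nhds_unique hL (hR.congr fun n => ?_)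
  refine (integral_regDensity_by_parts hκ hω (by positivity) ?_ i p).symm
  rw [div_le_one (by positivity)]
  linarith [Nat.cast_nonneg (α := ℝ) n]

end Icosahedral
end

noncomputable section
namespace Icosahedral

open MvPolynomial MeasureTheory

/-! ### The mean with respect to the density -/

/-- The mean of a polynomial with respect to the normalized density. -/
def gaussMean {κ ω : ℝ} (hκ : 0 < κ) (hω : 0 < ω) : MvPolynomial (Fin 3) ℝ →ₗ[ℝ] ℝ where
  toFun p := normConst κ ω * densityIntegral κ ω p
  map_add' p q := by
    simp only [densityIntegral, map_add, add_mul]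
    rw [integral_add (integrable_eval_density hκ hω p) (integrable_eval_density hκ hω q), mul_add]
  map_smul' a p := by
    simp only [densityIntegral, smul_eval, mul_assoc, RingHom.id_apply, smul_eq_mul]
    rw [integral_const_mul]
    ring

variable {κ ω : ℝ} (hκ : 0 < κ) (hω : 0 < ω)

theorem gaussMean_apply (p : MvPolynomial (Fin 3) ℝ) :
    gaussMean hκ hω p = normConst κ ω * densityIntegral κ ω p := rfl

theorem inner₂_eq (p q : MvPolynomial (Fin 3) ℝ) : inner₂ κ ω p q = gaussMean hκ hω (p * q) := by
  simp only [inner₂, gaussMean_apply, densityIntegral, map_mul]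

theorem gaussMean_one : gaussMean hκ hω 1 = 1 := by
  simp only [gaussMean_apply, densityIntegral, map_one, one_mul, normConst]
  exact inv_mul_cancel₀ (integral_density_pos hκ hω).ne'

theorem gaussMean_reflPoly {v : Fin 3 → ℝ} (hv : v ∈ posRoots) (p : MvPolynomial (Fin 3) ℝ) :
    gaussMean hκ hω (reflPoly v p) = gaussMean hκ hω p := by
  rw [gaussMean_apply, gaussMean_apply, densityIntegral, densityIntegral]
  congr 1
  rw [← integral_comp_reflection v fun x => eval x p * density κ ω x]
  simp only [eval_reflPoly, ← regDensity_zero, regDensity_reflection κ ω 0 hv]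

theorem gaussMean_dunkl (i : Fin 3) (p : MvPolynomial (Fin 3) ℝ) :
    gaussMean hκ hω (dunkl κ i p) = 2 * ω * gaussMean hκ hω (X i * p) := by
  have h := densityIntegral_dunkl hκ hω i p
  rw [dunkl, map_add, map_sum]
  simp only [← smul_eq_C_mul, map_smul, smul_eq_mul, gaussMean_apply]
  rw [mul_left_comm, h, mul_add, Finset.mul_sum]
  congr 1
  exact Finset.sum_congr rfl fun v _ => by ring

theorem reflPoly_linForm_self {v : Fin 3 → ℝ} (hv : v ∈ posRoots) :
    reflPoly v (linForm v) = -linForm v := by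
  rw [reflPoly_linForm, reflection_root hv, root_dot hv, ← linForm_neg]
  congr 1
  module

theorem reflPoly_reflPoly (v : Fin 3 → ℝ) (p : MvPolynomial (Fin 3) ℝ) :
    reflPoly v (reflPoly v p) = p :=
  MvPolynomial.funext fun x => by rw [eval_reflPoly, eval_reflPoly, reflection_reflection]

theorem reflPoly_dividedDiff {v : Fin 3 → ℝ} (hv : v ∈ posRoots) (p : MvPolynomial (Fin 3) ℝ) :
    reflPoly v (dividedDiff v p) = dividedDiff v p := by
  refine mul_left_cancel₀ (linForm_ne_zero hv) ?_
  have h := linForm_mul_dividedDiff v p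
  have h' := congrArg (reflPoly v) h
  rw [map_mul, map_sub, reflPoly_linForm_self hv, reflPoly_reflPoly] at h'
  linear_combination -h' - h

/-- The adjoint of a Dunkl operator. -/
theorem gaussMean_dunkl_mul_add (i : Fin 3) (p q : MvPolynomial (Fin 3) ℝ) :
    gaussMean hκ hω (dunkl κ i p * q) + gaussMean hκ hω (p * dunkl κ i q) =
      2 * ω * gaussMean hκ hω (X i * (p * q)) := by
  rw [← gaussMean_dunkl, dunkl_mul, map_sub, map_add, map_sum,
    Finset.sum_eq_zero fun v hv => ?_, sub_zero, add_comm, mul_comm q]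
  rw [← smul_eq_C_mul, map_smul]
  -- The correction term of `dunkl_mul` is an odd form times two `σ_v`-invariant quotients, so its
  -- mean equals its own negative.
  have h := gaussMean_reflPoly hκ hω hv (linForm v * dividedDiff v p * dividedDiff v q)
  rw [map_mul (reflPoly v), map_mul (reflPoly v), reflPoly_dividedDiff hv,
    reflPoly_dividedDiff hv, reflPoly_linForm_self hv, neg_mul, neg_mul, map_neg] at h
  rw [show gaussMean hκ hω (linForm v * dividedDiff v p * dividedDiff v q) = 0 by linarith,
    smul_zero]

theorem gaussMean_sum_X_mul_dunkl {p : MvPolynomial (Fin 3) ℝ} {d : ℕ} (hp : p.IsHomogeneous d) :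
    gaussMean hκ hω (∑ i, X i * dunkl κ i p) = d * gaussMean hκ hω p := by
  rw [sum_X_mul_dunkl, hp.sum_X_mul_pderiv, map_add, map_sum, Finset.sum_eq_zero fun v hv => by
    rw [← smul_eq_C_mul, map_smul, map_sub, gaussMean_reflPoly hκ hω hv, sub_self, smul_zero],
    add_zero, map_nsmul, nsmul_eq_mul]

theorem gaussMean_radiusSq_mul {p : MvPolynomial (Fin 3) ℝ} {d : ℕ} (hp : p.IsHomogeneous d) :
    2 * ω * gaussMean hκ hω (radiusSq * p) = (d + 3 + 30 * κ) * gaussMean hκ hω p := by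
  have h : gaussMean hκ hω (∑ i, dunkl κ i (X i * p)) =
      2 * ω * gaussMean hκ hω (radiusSq * p) := by
    rw [map_sum, radiusSq, Finset.sum_mul, map_sum, Finset.mul_sum]
    exact Finset.sum_congr rfl fun i _ => by rw [gaussMean_dunkl, ← mul_assoc, sq]
  rw [← h, sum_dunkl_X_mul, map_sub, map_add, gaussMean_sum_X_mul_dunkl hκ hω hp, map_sum,
    Finset.sum_eq_zero fun v hv => by
      rw [← smul_eq_C_mul, map_smul, map_sub, gaussMean_reflPoly hκ hω hv, sub_self, smul_zero],
    sub_zero, ← smul_eq_C_mul, map_smul, smul_eq_mul]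
  ring

/-! ### Hermite-type polynomials -/

/-- `q_{n - 2j} / ν(n - 2j)`, or zero if `n < 2j`. -/
def dunklPowShift (κ : ℝ) (n j : ℕ) (y : Fin 3 → ℝ) : MvPolynomial (Fin 3) ℝ :=
  if 2 * j ≤ n then dunklPow κ (n - 2 * j) y else 0

/-- The coefficients of the exponential of the Laplacian. -/
def hermiteCoeff (ω : ℝ) (j : ℕ) : ℝ :=
  (-1) ^ j * ((τ + 2) ^ j / ((4 * ω) ^ j * (j.factorial : ℝ)))

theorem hermiteCoeff_succ {ω : ℝ} (hω : 0 < ω) (j : ℕ) :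
    2 * ω * ((2 * (j + 1)) * hermiteCoeff ω (j + 1)) = -((τ + 2) * hermiteCoeff ω j) := by
  have : (j.factorial : ℝ) ≠ 0 := by positivity
  rw [hermiteCoeff, hermiteCoeff, Nat.factorial_succ]
  push_cast
  field_simp
  ring

/-- The polynomials `w_n / ν(n)`. -/
def hermitePow (κ ω : ℝ) (n : ℕ) (y : Fin 3 → ℝ) : MvPolynomial (Fin 3) ℝ :=
  ∑ j ∈ Finset.range (n + 1), hermiteCoeff ω j • dunklPowShift κ n j y

theorem w_eq (κ ω : ℝ) (n : ℕ) (y : Fin 3 → ℝ) : w κ ω n y = nu κ n • hermitePow κ ω n y := by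
  have hsub : Finset.range (n / 2 + 1) ⊆ Finset.range (n + 1) :=
    Finset.range_subset_range.2 (by omega)
  rw [hermitePow, ← Finset.sum_subset hsub fun j _ hj => by
    rw [dunklPowShift, if_neg (by rw [Finset.mem_range] at hj; omega), smul_zero], w,
    Finset.smul_sum]
  refine Finset.sum_congr rfl fun j hj => ?_
  rw [dunklPowShift, if_pos (by rw [Finset.mem_range] at hj; omega), dunklPow, smul_smul, smul_smul,
    ← smul_eq_C_mul, hermiteCoeff]
  congr 1
  ring

theorem dunkl_dunklPowShift (hκ : 0 < κ) (n j : ℕ) (i : Fin 3) {y : Fin 3 → ℝ}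
    (hy : y ∈ vertices) :
    dunkl κ i (dunklPowShift κ (n + 1) j y) = y i • dunklPowShift κ n j y := by
  unfold dunklPowShift
  split_ifs with h1 h2 h2
  · rw [show n + 1 - 2 * j = n - 2 * j + 1 by omega, dunkl_dunklPow_succ hκ _ _ hy]
  · rw [show n + 1 - 2 * j = 0 by omega, dunkl_dunklPow_zero, smul_zero]
  · omega
  · rw [← dunklLin_apply, map_zero, smul_zero]

theorem dunkl_hermitePow_succ (hκ : 0 < κ) (ω : ℝ) (n : ℕ) (i : Fin 3) {y : Fin 3 → ℝ}
    (hy : y ∈ vertices) :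
    dunkl κ i (hermitePow κ ω (n + 1) y) = y i • hermitePow κ ω n y := by
  rw [← dunklLin_apply, hermitePow, map_sum]
  simp only [map_smul, dunklLin_apply, dunkl_dunklPowShift hκ n _ i hy]
  -- The longer index range of `hermitePow (n + 1)` adds only `j = n + 1`, where the shifted
  -- polynomial is zero by default.
  rw [Finset.sum_range_succ, dunklPowShift, if_neg (by omega), smul_zero, smul_zero, add_zero,
    hermitePow, Finset.smul_sum]
  exact Finset.sum_congr rfl fun j _ => smul_comm _ _ _

theorem hermitePow_zero (κ ω : ℝ) (y : Fin 3 → ℝ) : hermitePow κ ω 0 y = 1 := by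
  simp [hermitePow, hermiteCoeff, dunklPowShift, dunklPow_zero]

/-- Euler's relation makes `n + 2` times the mean equal to the mean of `∑ x_i 𝒟_i E_{n+2}`; each
operator used is then lowered, and integrating by parts lowers once more, leaving `|y|²`. -/
theorem gaussMean_dunklPow (n : ℕ) {y : Fin 3 → ℝ} (hy : y ∈ vertices) :
    2 * ω * ((n + 2) * gaussMean hκ hω (dunklPow κ (n + 2) y)) =
      (τ + 2) * gaussMean hκ hω (dunklPow κ n y) := by
  have h := gaussMean_sum_X_mul_dunkl hκ hω (dunklPow_isHomogeneous κ (n + 2) y)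
  simp only [dunkl_dunklPow_succ hκ _ _ hy, mul_smul_comm, map_sum, map_smul] at h
  push_cast at h
  rw [← h, Finset.mul_sum, ← vertex_dot hy, dotProduct, Finset.sum_mul]
  refine Finset.sum_congr rfl fun i _ => ?_
  rw [smul_eq_mul, mul_left_comm, ← gaussMean_dunkl, dunkl_dunklPow_succ hκ _ _ hy, map_smul,
    smul_eq_mul, mul_assoc]

theorem gaussMean_dunklPow_one {y : Fin 3 → ℝ} (hy : y ∈ vertices) :
    gaussMean hκ hω (dunklPow κ 1 y) = 0 := by
  have h := gaussMean_sum_X_mul_dunkl hκ hω (dunklPow_isHomogeneous κ 1 y)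
  rw [Nat.cast_one, one_mul] at h
  rw [← h, map_sum]
  refine Finset.sum_eq_zero fun i _ => ?_
  have h0 := gaussMean_dunkl hκ hω i (dunklPow κ 0 y)
  rw [dunkl_dunklPow_zero, map_zero] at h0
  rw [show (1 : ℕ) = 0 + 1 from rfl, dunkl_dunklPow_succ hκ _ _ hy, mul_smul_comm, map_smul]
  rcases mul_eq_zero.1 h0.symm with h | h
  · linarith
  · rw [h, smul_zero]

theorem gaussMean_dunklPowShift (n j : ℕ) {y : Fin 3 → ℝ} (hy : y ∈ vertices) :
    2 * ω * (((n : ℝ) - 2 * j) * gaussMean hκ hω (dunklPowShift κ n j y)) =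
      (τ + 2) * gaussMean hκ hω (dunklPowShift κ n (j + 1) y) := by
  by_cases h : 2 * j + 2 ≤ n
  · obtain ⟨k, rfl⟩ := Nat.exists_eq_add_of_le h
    rw [dunklPowShift, dunklPowShift, if_pos (by omega), if_pos (by omega),
      show 2 * j + 2 + k - 2 * j = k + 2 by omega, show 2 * j + 2 + k - 2 * (j + 1) = k by omega,
      ← gaussMean_dunklPow hκ hω k hy]
    push_cast
    ring
  · rw [dunklPowShift, dunklPowShift, if_neg (show ¬2 * (j + 1) ≤ n by omega), map_zero, mul_zero]
    split_ifs with h1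
    · obtain rfl | rfl : n = 2 * j ∨ n = 2 * j + 1 := by omega
      · push_cast; ring
      · rw [show 2 * j + 1 - 2 * j = 1 by omega, gaussMean_dunklPow_one hκ hω hy]; ring
    · rw [map_zero, mul_zero, mul_zero]

/-- Split `n = (n - 2j) + 2j` in the `j`-th term. By the recursions for means and coefficients, the
first part is minus the second part of the next term, so the sum telescopes. -/
theorem gaussMean_hermitePow {n : ℕ} (hn : 0 < n) {y : Fin 3 → ℝ} (hy : y ∈ vertices) :
    gaussMean hκ hω (hermitePow κ ω n y) = 0 := by
  set f : ℕ → ℝ := fun j =>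
    2 * ω * (2 * j * hermiteCoeff ω j * gaussMean hκ hω (dunklPowShift κ n j y))
  have hstep : ∀ j, 2 * ω * (n * (hermiteCoeff ω j * gaussMean hκ hω (dunklPowShift κ n j y))) =
      f j - f (j + 1) := fun j => by
    have h1 := gaussMean_dunklPowShift hκ hω n j hy
    have h2 := hermiteCoeff_succ hω j
    simp only [f]
    push_cast
    linear_combination hermiteCoeff ω j * h1 +
      gaussMean hκ hω (dunklPowShift κ n (j + 1) y) * h2
  have hsum : 2 * ω * (n * gaussMean hκ hω (hermitePow κ ω n y)) = f 0 - f (n + 1) := by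
    rw [hermitePow, map_sum, Finset.mul_sum, Finset.mul_sum, ← Finset.sum_range_sub' f (n + 1)]
    exact Finset.sum_congr rfl fun j _ => by rw [map_smul, smul_eq_mul, hstep]
  have h0 : f 0 = 0 := by simp [f]
  have h1 : f (n + 1) = 0 := by
    simp only [f]
    rw [dunklPowShift, if_neg (by omega), map_zero, mul_zero, mul_zero]
  rw [h0, h1, sub_zero] at hsum
  have hn' : (n : ℝ) ≠ 0 := by positivity
  simpa [hω.ne', hn'] using hsum

/-! ### Orthogonality and the reproducing property. -/

theorem gaussMean_X_mul_hermitePow (n : ℕ) (i : Fin 3) (p : MvPolynomial (Fin 3) ℝ)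
    {y : Fin 3 → ℝ} (hy : y ∈ vertices) :
    2 * ω * gaussMean hκ hω (X i * p * hermitePow κ ω (n + 1) y) =
      gaussMean hκ hω (dunkl κ i p * hermitePow κ ω (n + 1) y) +
        y i * gaussMean hκ hω (p * hermitePow κ ω n y) := by
  rw [mul_assoc (X i), ← gaussMean_dunkl_mul_add, dunkl_hermitePow_succ hκ ω n i hy, mul_smul_comm,
    map_smul, smul_eq_mul]

theorem monomial_eq_X_mul {s : Fin 3 →₀ ℕ} (hs : s ≠ 0) (a : ℝ) :
    ∃ (i : Fin 3) (t : Fin 3 →₀ ℕ), t.degree + 1 = s.degree ∧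
      monomial s a = X i * monomial t a := by
  obtain ⟨i, hi⟩ : ∃ i, s i ≠ 0 := by
    by_contra! h
    exact hs (Finsupp.ext h)
  have hle : Finsupp.single i 1 ≤ s := by
    rw [Finsupp.single_le_iff]; omega
  refine ⟨i, s - Finsupp.single i 1, ?_, ?_⟩
  · conv_rhs => rw [← tsub_add_cancel_of_le hle, map_add]
    simp
  · rw [X, monomial_mul, one_mul, add_tsub_cancel_of_le hle]

/-- Peeling off a variable with the adjoint relation leaves one term with smaller `n` and one with a
polynomial of smaller degree, whence the nested inductions. Constants are covered by
`gaussMean_hermitePow`. -/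
theorem gaussMean_mul_hermitePow_of_lt {n : ℕ} {p : MvPolynomial (Fin 3) ℝ}
    (hp : p.totalDegree < n) {y : Fin 3 → ℝ} (hy : y ∈ vertices) :
    gaussMean hκ hω (p * hermitePow κ ω n y) = 0 := by
  induction n generalizing p with
  | zero => omega
  | succ n ihn =>
    obtain ⟨d, hd⟩ : ∃ d, p.totalDegree = d := ⟨_, rfl⟩
    induction d using Nat.strong_induction_on generalizing p with
    | _ d ihd =>
      conv_lhs => rw [p.as_sum, Finset.sum_mul, map_sum]
      refine Finset.sum_eq_zero fun s hs => ?_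
      have hsd : s.degree ≤ d := hd ▸ le_totalDegree hs
      by_cases h0 : s = 0
      · rw [h0, ← C_apply, ← smul_eq_C_mul, map_smul, gaussMean_hermitePow hκ hω n.succ_pos hy,
          smul_zero]
      · obtain ⟨i, t, ht, hst⟩ := monomial_eq_X_mul h0 (coeff s p)
        have hm : (monomial t (coeff s p)).totalDegree ≤ t.degree := totalDegree_monomial_le _ _
        have hD := totalDegree_dunkl_le κ i (monomial t (coeff s p))
        have h := gaussMean_X_mul_hermitePow hκ hω n i (monomial t (coeff s p)) hy
        rw [ihn (p := monomial t (coeff s p)) (by omega), ihd (dunkl κ i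
          (monomial t (coeff s p))).totalDegree (by omega) (by omega) rfl, mul_zero, add_zero] at h
        rw [hst]
        simpa [hω.ne'] using h

/-- Each variable removed contributes `y_i / (2ω)`; the term in which the Dunkl operator hits `p`
has too low a degree to survive. -/
theorem gaussMean_mul_hermitePow {n : ℕ} {p : MvPolynomial (Fin 3) ℝ}
    (hp : p.IsHomogeneous n) {y : Fin 3 → ℝ} (hy : y ∈ vertices) :
    (2 * ω) ^ n * gaussMean hκ hω (p * hermitePow κ ω n y) = eval y p := by
  suffices h : ∀ (n : ℕ) (s : Fin 3 →₀ ℕ) (a : ℝ), s.degree = n →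
      (2 * ω) ^ n * gaussMean hκ hω (monomial s a * hermitePow κ ω n y) =
        eval y (monomial s a) by
    conv_lhs => rw [p.as_sum, Finset.sum_mul, map_sum, Finset.mul_sum]
    conv_rhs => rw [p.as_sum, map_sum]
    refine Finset.sum_congr rfl fun s hs => h n s _ ?_
    have := hp (mem_support_iff.1 hs)
    exact (DFunLike.congr_fun (Finsupp.degree_eq_weight_one (R := ℕ)) s).trans this
  intro n
  induction n with
  | zero =>
    intro s a hs
    rw [Finsupp.degree_eq_zero_iff] at hs
    rw [hs, hermitePow_zero, mul_one, pow_zero, one_mul, ← C_apply, eval_C,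
      ← mul_one (C a), ← smul_eq_C_mul, map_smul, gaussMean_one, smul_eq_mul, mul_one]
  | succ n ih =>
    intro s a hs
    have h0 : s ≠ 0 := by
      rintro rfl
      simp at hs
    obtain ⟨i, t, ht, hst⟩ := monomial_eq_X_mul h0 a
    have hm : (monomial t a).totalDegree ≤ t.degree := totalDegree_monomial_le _ _
    have hD := totalDegree_dunkl_le κ i (monomial t a)
    have h := gaussMean_X_mul_hermitePow hκ hω n i (monomial t a) hy
    rw [gaussMean_mul_hermitePow_of_lt hκ hω (p := dunkl κ i (monomial t a)) (by omega) hy,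
      zero_add] at h
    rw [hst, pow_succ, mul_assoc, h, mul_left_comm, ih t a (by omega), map_mul, eval_X]

/-- Only the leading term of the first factor survives orthogonality, and it is reproduced at `y`.
-/
theorem gaussMean_hermitePow_mul_hermitePow (n : ℕ) {y : Fin 3 → ℝ} (hy : y ∈ vertices)
    (z : Fin 3 → ℝ) :
    (2 * ω) ^ n * gaussMean hκ hω (hermitePow κ ω n z * hermitePow κ ω n y) =
      eval y (dunklPow κ n z) := by
  rw [← gaussMean_mul_hermitePow hκ hω (dunklPow_isHomogeneous κ n z) hy]
  congr 1
  conv_lhs => rw [hermitePow, Finset.sum_mul, map_sum]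
  rw [Finset.sum_eq_single 0]
  · simp [hermiteCoeff, dunklPowShift]
  · intro j _ hj
    rw [dunklPowShift]
    split_ifs with h
    · rw [smul_mul_assoc, map_smul, gaussMean_mul_hermitePow_of_lt hκ hω _ hy, smul_zero]
      have := (dunklPow_isHomogeneous κ (n - 2 * j) z).totalDegree_le
      omega
    · rw [smul_zero, zero_mul, map_zero]
  · simp

theorem eval_dunklPowG (hκ : 0 < κ) (n : ℕ) {y : Fin 3 → ℝ} (hy : y ∈ vertices) :
    eval y (dunklPowG κ (2 * n)) = τ ^ (2 * n) * Y2 κ n / nu κ (2 * n) := by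
  simp only [dunklPowG, map_sum, dunklPow, smul_eval]
  rw [← Finset.mul_sum, sum_eval_q n hy, Y0_add_Y1 hκ, inv_mul_eq_div]

theorem normSq₂_wG (hκ : 0 < κ) (hω : 0 < ω) (n : ℕ) : normSq₂ κ ω (wG κ ω n) =
    6 * τ ^ (2 * n) * (nu κ (2 * n) / (2 * ω) ^ (2 * n)) * Y2 κ n := by
  have hpow : (2 * ω) ^ (2 * n) ≠ 0 := by positivity
  have hnu := (nu_pos hκ (2 * n)).ne'
  have h : (2 * ω) ^ (2 * n) * normSq₂ κ ω (wG κ ω n) =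
      ∑ y ∈ posVertices, nu κ (2 * n) ^ 2 * eval y (dunklPowG κ (2 * n)) := by
    rw [normSq₂, inner₂_eq hκ hω, wG]
    simp only [w_eq, ← Finset.smul_sum]
    rw [smul_mul_smul_comm, map_smul, Finset.mul_sum, map_sum, ← Finset.mul_sum, smul_eq_mul,
      mul_left_comm, Finset.mul_sum, sq]
    congr 1
    refine Finset.sum_congr rfl fun y hy => ?_
    rw [Finset.sum_mul, map_sum, Finset.mul_sum, dunklPowG, map_sum]
    exact Finset.sum_congr rfl fun z _ =>
      gaussMean_hermitePow_mul_hermitePow hκ hω _ (posVertices_subset hy) z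
  rw [Finset.sum_congr rfl fun y hy => by rw [eval_dunklPowG hκ n (posVertices_subset hy)],
    Finset.sum_const, card_posVertices] at h
  refine mul_left_cancel₀ hpow (h.trans ?_)
  rw [nsmul_eq_mul]
  push_cast
  field_simp

/-! ### The norm of the harmonic invariant -/

/-- Two evaluations of `∑ ⟨𝒟_i p, 𝒟_i r⟩` give a Green identity. Invariance makes `∑ x_i 𝒟_i` act as
the degree, so for harmonic `p` the product `2ω (2n - 2k) ⟨p, r⟩` is `-⟨p, Δ_κ r⟩`, and `Δ_κ` lowers
`k`. -/
theorem gaussMean_phiG_mul_dunklPowG {n k : ℕ} (hk : k < n) :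
    gaussMean hκ hω (phiG κ n * dunklPowG κ (2 * k)) = 0 := by
  have key : ∀ k : ℕ, 2 * ω * ((2 * n : ℕ) - (2 * k : ℕ)) *
      gaussMean hκ hω (phiG κ n * dunklPowG κ (2 * k)) =
      -gaussMean hκ hω (phiG κ n * dunklLaplacian κ (dunklPowG κ (2 * k))) := fun k => by
    set p := phiG κ n with hp
    set r := dunklPowG κ (2 * k)
    have hpE := sum_X_mul_dunkl_of_invariant κ (phiG_isHomogeneous κ n) fun v hv =>
      reflPoly_phiG κ n hv
    have hrE := sum_X_mul_dunkl_of_invariant κ (dunklPowG_isHomogeneous κ (2 * k)) fun v hv =>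
      reflPoly_dunklPowG κ k hv
    have h1 : gaussMean hκ hω (dunklLaplacian κ p * r) +
        ∑ i, gaussMean hκ hω (dunkl κ i p * dunkl κ i r) =
        2 * ω * ((2 * n : ℕ) * gaussMean hκ hω (p * r)) := by
      rw [dunklLaplacian, Finset.sum_mul, map_sum, ← Finset.sum_add_distrib]
      simp only [gaussMean_dunkl_mul_add hκ hω, ← mul_assoc (X _)]
      rw [← Finset.mul_sum, ← map_sum, ← Finset.sum_mul, hpE, smul_mul_assoc, map_smul, smul_eq_mul]
    have h2 : ∑ i, gaussMean hκ hω (dunkl κ i p * dunkl κ i r) +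
        gaussMean hκ hω (p * dunklLaplacian κ r) =
        2 * ω * ((2 * k : ℕ) * gaussMean hκ hω (p * r)) := by
      rw [dunklLaplacian, Finset.mul_sum, map_sum, ← Finset.sum_add_distrib]
      simp only [gaussMean_dunkl_mul_add hκ hω, mul_left_comm (X _) p]
      rw [← Finset.mul_sum, ← map_sum, ← Finset.mul_sum, hrE, mul_smul_comm, map_smul, smul_eq_mul]
    rw [hp, dunklLaplacian_phiG hκ n, ← hp, zero_mul, map_zero, zero_add] at h1
    linear_combination h2 - h1
  have hne : ∀ k < n, 2 * ω * ((2 * n : ℕ) - (2 * k : ℕ) : ℝ) ≠ 0 := fun k hk =>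
    mul_ne_zero (by positivity) (sub_ne_zero.2 (by exact_mod_cast (by omega : 2 * n ≠ 2 * k)))
  induction k with
  | zero =>
    have h := key 0
    rw [mul_zero, dunklLaplacian_dunklPowG_zero, mul_zero, map_zero, neg_zero] at h
    exact (mul_eq_zero.1 h).resolve_left (hne 0 hk)
  | succ k ih =>
    have h := key (k + 1)
    rw [mul_add 2 k 1, mul_one, dunklLaplacian_dunklPowG hκ, mul_smul_comm, map_smul,
      ih (by omega), smul_zero, neg_zero] at h
    exact (mul_eq_zero.1 h).resolve_left (hne (k + 1) hk)

/-- On homogeneous polynomials, a factor `|x|²` changes the mean only by a constant multiple. -/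
theorem gaussMean_phiG_mul_radiusSq_pow_mul {n k : ℕ} (hk : k < n) (j : ℕ) :
    gaussMean hκ hω (phiG κ n * (radiusSq ^ j * dunklPowG κ (2 * k))) = 0 := by
  induction j with
  | zero => rw [pow_zero, one_mul, gaussMean_phiG_mul_dunklPowG hκ hω hk]
  | succ j ih =>
    have h := gaussMean_radiusSq_mul hκ hω ((phiG_isHomogeneous κ n).mul
      ((radiusSq_isHomogeneous.pow j).mul (dunklPowG_isHomogeneous κ (2 * k))))
    rw [ih, mul_zero] at h
    rw [pow_succ', mul_assoc, mul_left_comm]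
    exact (mul_eq_zero.1 h).resolve_left (by positivity)

theorem gaussMean_phiG_mul_phiG (n : ℕ) :
    gaussMean hκ hω (phiG κ n * phiG κ n) =
      nu κ (2 * n) * gaussMean hκ hω (phiG κ n * dunklPowG κ (2 * n)) := by
  conv_lhs =>
    enter [2, 2]
    rw [phiG_eq κ n]
  rw [mul_smul_comm, map_smul, smul_eq_mul, Finset.mul_sum, map_sum]
  congr 1
  rw [Finset.sum_eq_single 0]
  · simp [harmCoeff, poch_zero]
  · intro j hj hj0
    rw [Finset.mem_range] at hj
    rw [mul_smul_comm, map_smul, gaussMean_phiG_mul_radiusSq_pow_mul hκ hω (by omega), smul_zero]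
  · simp

/-- The lower terms of the Hermite sums are orthogonal to `φ_{2n}^G`, so its top invariant may be
replaced by the full Hermite sum, which reproduces values at the vertices. -/
theorem gaussMean_phiG_mul_dunklPowG_self (n : ℕ) :
    (2 * ω) ^ (2 * n) * gaussMean hκ hω (phiG κ n * dunklPowG κ (2 * n)) =
      ∑ y ∈ posVertices, eval y (phiG κ n) := by
  rw [← Finset.sum_congr rfl fun y hy => gaussMean_mul_hermitePow hκ hω (phiG_isHomogeneous κ n)
    (posVertices_subset hy), ← Finset.mul_sum, ← map_sum, ← Finset.mul_sum]
  congr 1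
  simp only [hermitePow]
  rw [Finset.sum_comm, Finset.mul_sum, map_sum, Finset.sum_eq_single 0]
  · simp [hermiteCoeff, dunklPowShift, dunklPowG]
  · intro j _ hj
    simp only [dunklPowShift]
    split_ifs with h
    · rw [← Finset.smul_sum, show 2 * n - 2 * j = 2 * (n - j) by omega, mul_smul_comm, map_smul]
      have := gaussMean_phiG_mul_dunklPowG hκ hω (show n - j < n by omega)
      rw [dunklPowG] at this
      rw [this, smul_zero]
    · simp
  · simp

/-! ### Values of the harmonic invariant at the vertices. -/

theorem poch_neg_mul_poch (a : ℝ) (k j : ℕ) :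
    poch (-(a + k + j - 1)) j * poch a k = (-1) ^ j * poch a (k + j) := by
  induction j with
  | zero => simp [poch_zero]
  | succ j ih =>
    rw [poch_succ_left, ← add_assoc, poch_succ,
      show -(a + k + (j + 1 : ℕ) - 1) + 1 = -(a + k + j - 1) by push_cast; ring, mul_assoc, ih]
    push_cast
    ring

theorem nu_two_mul (κ : ℝ) (n : ℕ) :
    nu κ (2 * n) = 4 ^ n * poch (6 * κ + 1) n * poch (5 * κ + 1 / 2) n := by
  rw [nu, pow_mul, show 2 * n / 2 = n by omega, show (2 * n + 1) / 2 = n by omega]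
  norm_num

/-- The last `j` factors of each Pochhammer symbol are read backwards; the two signs `(-1)^j`
cancel. -/
theorem nu_eq_mul_nu (κ : ℝ) {n j : ℕ} (hj : j ≤ n) :
    nu κ (2 * n) = 4 ^ j * poch (-6 * κ - n) j * poch (-5 * κ - n + 1 / 2) j *
      nu κ (2 * (n - j)) := by
  obtain ⟨k, rfl⟩ := Nat.exists_eq_add_of_le' hj
  have h1 := poch_neg_mul_poch (6 * κ + 1) k j
  have h2 := poch_neg_mul_poch (5 * κ + 1 / 2) k j
  rw [show -(6 * κ + 1 + k + j - 1) = -6 * κ - ((k + j : ℕ) : ℝ) by push_cast; ring] at h1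
  rw [show -(5 * κ + 1 / 2 + k + j - 1) = -5 * κ - ((k + j : ℕ) : ℝ) + 1 / 2 by
    push_cast; ring] at h2
  rw [nu_two_mul, nu_two_mul, Nat.add_sub_cancel, pow_add]
  have hs : ((-1 : ℝ) ^ j) * (-1) ^ j = 1 := by rw [← mul_pow]; norm_num
  calc _ = 4 ^ k * 4 ^ j * (((-1 : ℝ) ^ j) * (-1) ^ j) *
        (poch (6 * κ + 1) (k + j) * poch (5 * κ + 1 / 2) (k + j)) := by rw [hs]; ring
    _ = 4 ^ k * 4 ^ j * (((-1 : ℝ) ^ j * poch (6 * κ + 1) (k + j)) *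
        ((-1) ^ j * poch (5 * κ + 1 / 2) (k + j))) := by ring
    _ = _ := by rw [← h1, ← h2]; ring

/-- One power `(τ + 2)^j` comes from `|y|^{2j}` and one from the coefficient; together they are `5^j
τ^{2j}`. The `4^j` in the denominator cancels against the ratio of the `ν`. -/
theorem eval_phiG (hκ : 0 < κ) (n : ℕ) {y : Fin 3 → ℝ} (hy : y ∈ vertices) :
    eval y (phiG κ n) = τ ^ (2 * n) * ∑ j ∈ Finset.range (n + 1),
      5 ^ j * poch (-6 * κ - (n : ℝ)) j * poch (-5 * κ - (n : ℝ) + 1 / 2) j /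
        ((j.factorial : ℝ) * poch (-15 * κ - 2 * (n : ℝ) + 1 / 2) j) * Y2 κ (n - j) := by
  have hr : eval y radiusSq = τ + 2 := by
    rw [← vertex_dot hy]
    simp [radiusSq, dotProduct, sq]
  rw [phiG_eq, smul_eval, map_sum, Finset.mul_sum, Finset.mul_sum]
  refine Finset.sum_congr rfl fun j hj => ?_
  have hj' : j ≤ n := by simpa [Nat.lt_succ_iff] using hj
  have hτ : τ ^ (2 * n) = (τ ^ 2) ^ j * τ ^ (2 * (n - j)) := by
    rw [← pow_mul, ← pow_add]
    congr 1
    omega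
  have hp : (τ + 2) ^ j * (τ + 2) ^ j = 5 ^ j * (τ ^ 2) ^ j := by
    rw [← mul_pow, ← sq, tau_add_two_sq, mul_pow]
  have hnu := (nu_pos hκ (2 * (n - j))).ne'
  rw [smul_eval, map_mul, map_pow, hr, eval_dunklPowG hκ _ hy, nu_eq_mul_nu κ hj', harmCoeff, hτ]
  push_cast
  set B := poch (-15 * κ - 2 * (n : ℝ) + 1 / 2) j
  set A₁ := poch (-6 * κ - (n : ℝ)) j
  set A₂ := poch (-5 * κ - (n : ℝ) + 1 / 2) j
  have h4 : (4 : ℝ) ^ j ≠ 0 := by positivity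
  rw [mul_assoc ((4 : ℝ) ^ j), ← div_div, ← div_div]
  calc _ = ((τ + 2) ^ j * (τ + 2) ^ j) * (A₁ * A₂) * (τ ^ (2 * (n - j)) * Y2 κ (n - j)) *
        (4 ^ j / 4 ^ j) * (nu κ (2 * (n - j)) / nu κ (2 * (n - j))) / j.factorial / B := by ring
    _ = _ := by rw [hp, div_self h4, div_self hnu]; ring

theorem normSq₂_phiG (hκ : 0 < κ) (hω : 0 < ω) (n : ℕ) : normSq₂ κ ω (phiG κ n) =
    6 * τ ^ (2 * n) * (nu κ (2 * n) / (2 * ω) ^ (2 * n)) * ∑ j ∈ Finset.range (n + 1),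
      5 ^ j * poch (-6 * κ - (n : ℝ)) j * poch (-5 * κ - (n : ℝ) + 1 / 2) j /
        ((j.factorial : ℝ) * poch (-15 * κ - 2 * (n : ℝ) + 1 / 2) j) * Y2 κ (n - j) := by
  have hpow : (2 * ω) ^ (2 * n) ≠ 0 := by positivity
  have h := gaussMean_phiG_mul_dunklPowG_self hκ hω n
  rw [Finset.sum_congr rfl fun y hy => eval_phiG hκ n (posVertices_subset hy), Finset.sum_const,
    card_posVertices, nsmul_eq_mul] at h
  rw [normSq₂, inner₂_eq hκ hω, gaussMean_phiG_mul_phiG]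
  refine mul_left_cancel₀ hpow ?_
  rw [mul_left_comm, h]
  push_cast
  field_simp

theorem integrable_sq_mul_density (hκ : 0 < κ) (hω : 0 < ω) (p : MvPolynomial (Fin 3) ℝ) :
    Integrable fun x : Fin 3 → ℝ => eval x p ^ 2 * density κ ω x := by
  refine (integrable_eval_density hκ hω (p ^ 2)).congr (ae_of_all _ fun x => ?_)
  exact congrArg (· * density κ ω x) (map_pow (eval x) p 2)

end Icosahedral
end

theorem mainTheorem9 (κ ω : ℝ) (hκ : 0 < κ) (hω : 0 < ω) (n : ℕ) :
    -- the polynomial is homogeneous of degree 2n, invariant and harmonic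
    (Icosahedral.phiG κ n).IsHomogeneous (2 * n) ∧
    Icosahedral.IsInvariant (Icosahedral.phiG κ n) ∧
    Icosahedral.dunklLaplacian κ (Icosahedral.phiG κ n) = 0 ∧
    -- the integrals that define the squared norms converge
    MeasureTheory.Integrable (Icosahedral.density κ ω) ∧
    0 < (∫ x : Fin 3 → ℝ, Icosahedral.density κ ω x) ∧
    MeasureTheory.Integrable (fun x : Fin 3 → ℝ =>
      MvPolynomial.eval x (Icosahedral.phiG κ n) ^ 2 * Icosahedral.density κ ω x) ∧
    MeasureTheory.Integrable (fun x : Fin 3 → ℝ =>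
      MvPolynomial.eval x (Icosahedral.wG κ ω n) ^ 2 * Icosahedral.density κ ω x) ∧
    -- the squared norm of the harmonic invariant
    Icosahedral.normSq₂ κ ω (Icosahedral.phiG κ n) =
      6 * Icosahedral.τ ^ (2 * n) * (Icosahedral.nu κ (2 * n) / (2 * ω) ^ (2 * n)) *
        ∑ j ∈ Finset.range (n + 1),
          5 ^ j * Icosahedral.poch (-6 * κ - (n : ℝ)) j *
            Icosahedral.poch (-5 * κ - (n : ℝ) + 1 / 2) j /
            ((j.factorial : ℝ) * Icosahedral.poch (-15 * κ - 2 * (n : ℝ) + 1 / 2) j) *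
            Icosahedral.Y2 κ (n - j) ∧
    -- the identity between the three sums
    Icosahedral.Y0 κ n + 5 * Icosahedral.Y1 κ n = Icosahedral.Y2 κ n ∧
    -- the squared norm of the invariant wavefunction polynomial
    Icosahedral.normSq₂ κ ω (Icosahedral.wG κ ω n) =
      6 * Icosahedral.τ ^ (2 * n) * (Icosahedral.nu κ (2 * n) / (2 * ω) ^ (2 * n)) *
        Icosahedral.Y2 κ n := by
  exact ⟨Icosahedral.phiG_isHomogeneous κ n,
    Icosahedral.isInvariant_of_reflPoly fun _ hv => Icosahedral.reflPoly_phiG κ n hv,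
    Icosahedral.dunklLaplacian_phiG hκ n,
    Icosahedral.integrable_density hκ hω,
    Icosahedral.integral_density_pos hκ hω,
    Icosahedral.integrable_sq_mul_density hκ hω _,
    Icosahedral.integrable_sq_mul_density hκ hω _,
    Icosahedral.normSq₂_phiG hκ hω n,
    Icosahedral.Y0_add_Y1 hκ n,
    Icosahedral.normSq₂_wG hκ hω n⟩
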